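/- Let $n,m\ge 1$, $p\in(1,\infty)$, let $\Omega\subseteq\mathbb R^n$ be open, $D\subseteq\mathbb R^n$ bounded and open, and let $\mathcal G$ be a subgroup of $\mathrm{SO}(n)$. For $\varepsilon>0$ let $\Gamma_\varepsilon$ be the set of maps $x\mapsto\varepsilon Rx+h$ with $R\in\mathcal G$, $h\in\mathbb R^n$, let $\Gamma=\bigcup_{\varepsilon>0}\Gamma_\varepsilon$, and call $F(D)$, $F\in\Gamma$, the images of $D$. Let $|\cdot|_2$ denote the operator norm on $\mathbb R^{m\times n}$. Let $\alpha_p(u,D')\in[0,\infty)$ be defined for $u\in L^p_{\rm loc}(\mathbb R^n;\mathbb R^m)$ and $D'$ an image of $D$, and assume that $\alpha_p$ is a *$p$-core functional*: for all such $u,v,D'$ - $\alpha_p(u,D')=\alpha_p(v,D')$ if $u=v$ a.e. on $D'$; - $\alpha_p(\cdot,D')$ is convex; - $\alpha_p(tu,D')=|t|^p\alpha_p(u,D')$ for $t\in\mathbb R$; - $\alpha_p(u+h,D')=\alpha_p(u,D')$ for $h\in\mathbb R^m$; - $\alpha_p(u\circ F,D')=\alpha_p(u,F(D'))$ for $F\in\Gamma$;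 - there is $c_1>0$ with $\alpha_p(u,D)\le c_1\int_D|\nabla u|_2^p\,dx$ for all $u\in L^p_{\rm loc}(\mathbb R^n;\mathbb R^m)$ with $u|_D\in W^{1,p}(D;\mathbb R^m)$. Assume also that $\alpha_p(\cdot,D')$ is lower semicontinuous on $L^p(\mathbb R^n;\mathbb R^m)$ for every image $D'$ of $D$. For $u\in L^p_{\rm loc}(\mathbb R^n;\mathbb R^m)$ and an open set $U\subseteq\mathbb R^n$ put $$G_\varepsilon(u,U)=\varepsilon^{n-p}\sup_{\mathcal F}\sum_{D'\in\mathcal F}\alpha_p(u,D')\in[0,\infty],$$ where $\mathcal F$ ranges over all families of pairwise disjoint sets $F(D)\subseteq U$ with $F\in\Gamma_\varepsilon$ (the supremum is $0$ if only $\mathcal F=\emptyset$ is available). For $A\in\mathbb R^{m\times n}$ put $$\psi_{\alpha_p}(A)=\lim_{\varepsilon\to0^+}G_\varepsilon\bigl(x\mapsto Ax,(-\tfrac12,\tfrac12)^n\bigr).$$ For a linear map $\mathfrak L:\mathbb R^{m\times n}\to\mathbb R^{m\times n}$ let $D_{\mathfrak L}(u|_\Omega)$ be the matrix of distributions $\varphi\mapsto-\int_\Omega\mathfrak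 L(u\otimes\nabla\varphi)\,dx$, $\varphi\in C_c^\infty(\Omega)$; it belongs to $L^p(\Omega;\mathbb R^{m\times n})$ if it is represented by a function of that space, and $D_{\rm id}=\nabla$ is the distributional gradient. Then: 1. For every $A$ the limit $\psi_{\alpha_p}(A)$ exists in $[0,\infty)$, and $\mathcal N=\{A:\psi_{\alpha_p}(A)=0\}$ is a linear subspace of $\mathbb R^{m\times n}$. 2. Let $\mathcal P$ be any linear subspace with $\mathbb R^{m\times n}=\mathcal P\oplus\mathcal N$ and let $\pi_{\mathcal P}$ be the projection onto $\mathcal P$ along $\mathcal N$. For every $u\in L^p_{\rm loc}(\mathbb R^n;\mathbb R^m)$, $$\liminf_{\varepsilon\to0^+}G_\varepsilon(u,\Omega)<\infty\ \Longrightarrow\ D_{\pi_{\mathcal P}}(u|_\Omega)\in L^p(\Omega;\mathbb R^{m\times n}).$$ 3. If $\psi_{\alpha_p}(A)>0$ for every $A\ne0$, then for every $u\in L^p_{\rm loc}(\mathbb R^n;\mathbb R^m)$, $$\nabla(u|_\Omega)\in L^p(\Omega;\mathbb R^{m\times n})\iff\liminf_{\varepsilon\to0^+}G_\varepsilon(u,\Omega)<\infty.$$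 -/

import Mathlib

open MeasureTheory Filter Topology
open scoped ENNReal NNReal

noncomputable section

namespace BMOType

/-- The Euclidean space `ℝⁿ`. -/
abbrev E (n : ℕ) : Type := EuclideanSpace ℝ (Fin n)

/-- The space `ℝ^{m×n}` of real `m × n` matrices, each identified with the linear map
`l^A : ℝⁿ → ℝᵐ`, `x ↦ A x`; its norm is the operator norm with respect to the Euclidean norms. -/
abbrev Mat (m n : ℕ) : Type := E n →L[ℝ] E m

/-- `u ∈ L^p_loc(ℝⁿ; ℝᵐ)`. -/
def MemLpLoc {n m : ℕ} (p : ℝ) (u : E n → E m) : Prop :=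
  ∀ K : Set (E n), IsCompact K → MemLp u (ENNReal.ofReal p) (volume.restrict K)

/-- The matrix field `u ⊗ ∇φ`, i.e. `(u ⊗ ∇φ)(x)_{kl} = u_k(x) ∂_l φ(x)`. -/
def tensorGrad {n m : ℕ} (u : E n → E m) (φ : E n → ℝ) (x : E n) : Mat m n :=
  (fderiv ℝ φ x).smulRight (u x)

/-- On the open set `Ω`, the matrix of distributions `D_L u`, which sends a test function `φ` to
`-∫_Ω L (u ⊗ ∇φ)`, is represented by the function `g`. -/
def HasWeakD {n m : ℕ} (L : Mat m n →ₗ[ℝ] Mat m n) (Ω : Set (E n)) (u : E n → E m)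
    (g : E n → Mat m n) : Prop :=
  ∀ φ : E n → ℝ, ContDiff ℝ ((⊤ : ℕ∞) : WithTop ℕ∞) φ → HasCompactSupport φ → tsupport φ ⊆ Ω →
    ∫ x in Ω, φ x • g x = -∫ x in Ω, L (tensorGrad u φ x)

/-- `D_L (u|_Ω) ∈ L^p(Ω; ℝ^{m×n})`. -/
def WeakDMemLp {n m : ℕ} (p : ℝ) (L : Mat m n →ₗ[ℝ] Mat m n) (Ω : Set (E n))
    (u : E n → E m) : Prop :=
  ∃ g : E n → Mat m n, MemLp g (ENNReal.ofReal p) (volume.restrict Ω) ∧ HasWeakD L Ω u g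

/-- `∇ (u|_Ω) ∈ L^p(Ω; ℝ^{m×n})`. -/
def GradMemLp {n m : ℕ} (p : ℝ) (Ω : Set (E n)) (u : E n → E m) : Prop :=
  WeakDMemLp p LinearMap.id Ω u

/-- The class of all images `F(D)`, `F ∈ Γ`, that are contained in `Ω`. -/
def images {n : ℕ} (D : Set (E n)) (Γ : Set (E n ≃ᵃ[ℝ] E n)) (Ω : Set (E n)) :
    Set (Set (E n)) :=
  {D' | (∃ F ∈ Γ, D' = F '' D) ∧ D' ⊆ Ω}

/-- `α` is a `p`-core functional subordinated to the reference set `D` and to the subgroup `Γ` of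
the affine group. Only the values `α u D'` with `u ∈ L^p_loc(ℝⁿ; ℝᵐ)` and `D'` an image of `D`
under an element of `Γ` are meaningful. -/
structure IsCoreFunctional {n m : ℕ} (p : ℝ) (D : Set (E n)) (Γ : Subgroup (E n ≃ᵃ[ℝ] E n))
    (α : (E n → E m) → Set (E n) → ℝ≥0) : Prop where
  /-- extension independence -/
  ext_indep : ∀ D' ∈ images D (Γ : Set (E n ≃ᵃ[ℝ] E n)) Set.univ, ∀ u v : E n → E m,
    MemLpLoc p u → MemLpLoc p v → u =ᵐ[volume.restrict D'] v → α u D' = α v D'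
  /-- convexity -/
  convex : ∀ D' ∈ images D (Γ : Set (E n ≃ᵃ[ℝ] E n)) Set.univ,
    ∀ u v : E n → E m, MemLpLoc p u → MemLpLoc p v → ∀ t : ℝ, 0 ≤ t → t ≤ 1 →
      (α (t • u + (1 - t) • v) D' : ℝ) ≤ t * (α u D' : ℝ) + (1 - t) * (α v D' : ℝ)
  /-- `p`-homogeneity -/
  homogeneous : ∀ D' ∈ images D (Γ : Set (E n ≃ᵃ[ℝ] E n)) Set.univ,
    ∀ u : E n → E m, MemLpLoc p u → ∀ t : ℝ, (α (t • u) D' : ℝ) = |t| ^ p * (α u D' : ℝ)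
  /-- translation invariance -/
  trans_inv : ∀ D' ∈ images D (Γ : Set (E n ≃ᵃ[ℝ] E n)) Set.univ,
    ∀ u : E n → E m, MemLpLoc p u → ∀ h : E m, α (fun x => u x + h) D' = α u D'
  /-- change of variable -/
  change_var : ∀ D' ∈ images D (Γ : Set (E n ≃ᵃ[ℝ] E n)) Set.univ,
    ∀ u : E n → E m, MemLpLoc p u → ∀ F ∈ Γ, α (u ∘ F) D' = α u (F '' D')
  /-- gradient bound, for `u|_D ∈ W^{1,p}(D; ℝᵐ)` with weak gradient `g` -/
  grad_bound : ∃ c₁ : ℝ, 0 < c₁ ∧ ∀ u : E n → E m, MemLpLoc p u → ∀ g : E n → Mat m n,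
    MemLp u (ENNReal.ofReal p) (volume.restrict D) →
    MemLp g (ENNReal.ofReal p) (volume.restrict D) →
    HasWeakD LinearMap.id D u g → (α u D : ℝ) ≤ c₁ * ∫ x in D, ‖g x‖ ^ p

/-- The set `Γ_ε` of the maps `x ↦ ε R x + h` with `R ∈ G` and `h ∈ ℝⁿ`. -/
def similarities {n : ℕ} (G : Subgroup (Matrix.specialOrthogonalGroup (Fin n) ℝ)) (ε : ℝ) :
    Set (E n ≃ᵃ[ℝ] E n) :=
  {F | ∃ R ∈ G, ∃ h : E n, ∀ x, F x =
    ε • Matrix.toEuclideanCLM (𝕜 := ℝ) (R : Matrix (Fin n) (Fin n) ℝ) x + h}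

/-- The group `⋃_{ε > 0} Γ_ε`. -/
def similarityGroup {n : ℕ} (G : Subgroup (Matrix.specialOrthogonalGroup (Fin n) ℝ)) :
    Subgroup (E n ≃ᵃ[ℝ] E n) where
  carrier := {F | ∃ ε : ℝ, 0 < ε ∧ F ∈ similarities G ε}
  one_mem' := ⟨1, one_pos, 1, G.one_mem, 0, fun x => by simp⟩
  mul_mem' := by
    rintro F₁ F₂ ⟨ε₁, h₁, R₁, hR₁, a₁, e₁⟩ ⟨ε₂, h₂, R₂, hR₂, a₂, e₂⟩
    refine ⟨ε₁ * ε₂, mul_pos h₁ h₂, R₁ * R₂, G.mul_mem hR₁ hR₂,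
      ε₁ • Matrix.toEuclideanCLM (𝕜 := ℝ) (R₁ : Matrix (Fin n) (Fin n) ℝ) a₂ + a₁, fun x => ?_⟩
    rw [AffineEquiv.coe_mul, Function.comp_apply, e₁, e₂, Submonoid.coe_mul, map_mul]
    simp only [map_add, map_smul, smul_add, smul_smul, mul_apply_eq_comp, add_assoc]
  inv_mem' := by
    rintro F ⟨ε, hε, R, hR, a, e⟩
    refine ⟨ε⁻¹, inv_pos.2 hε, R⁻¹, G.inv_mem hR, -(ε⁻¹ • Matrix.toEuclideanCLM (𝕜 := ℝ)
      ((R⁻¹ : Matrix.specialOrthogonalGroup (Fin n) ℝ) : Matrix (Fin n) (Fin n) ℝ) a), fun x => ?_⟩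
    have hRR : ((R⁻¹ : Matrix.specialOrthogonalGroup (Fin n) ℝ) : Matrix (Fin n) (Fin n) ℝ) *
        (R : Matrix (Fin n) (Fin n) ℝ) = 1 := by
      rw [← Submonoid.coe_mul, inv_mul_cancel, Submonoid.coe_one]
    have key : ∀ y : E n, Matrix.toEuclideanCLM (𝕜 := ℝ)
        ((R⁻¹ : Matrix.specialOrthogonalGroup (Fin n) ℝ) : Matrix (Fin n) (Fin n) ℝ)
        (Matrix.toEuclideanCLM (𝕜 := ℝ) (R : Matrix (Fin n) (Fin n) ℝ) y) = y := fun y => by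
      rw [← mul_apply_eq_comp, ← map_mul, hRR, map_one]; rfl
    have hx : x = F (F⁻¹ x) := by rw [AffineEquiv.inv_def]; simp
    conv_rhs => rw [hx, e]
    rw [map_add, map_smul, key, smul_add, smul_smul, inv_mul_cancel₀ hε.ne', one_smul,
      add_neg_cancel_right]

/-- The generalized BMO-type seminorm `G_ε(u, Ω)`: the supremum is over all families of pairwise
disjoint subsets of `Ω` of the form `ε R(D) + h`, with `R ∈ G` and `h ∈ ℝⁿ`. -/
def bmo {n m : ℕ} (p : ℝ) (D : Set (E n)) (G : Subgroup (Matrix.specialOrthogonalGroup (Fin n) ℝ))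
    (α : (E n → E m) → Set (E n) → ℝ≥0) (ε : ℝ) (u : E n → E m) (Ω : Set (E n)) : ℝ≥0∞ :=
  ENNReal.ofReal (ε ^ ((n : ℝ) - p)) *
    ⨆ 𝓕 : {𝓕 : Set (Set (E n)) // 𝓕 ⊆ images D (similarities G ε) Ω ∧ 𝓕.PairwiseDisjoint id},
      ∑' D' : 𝓕.1, (α u D' : ℝ≥0∞)

/-- `G_-(u, Ω) = liminf_{ε → 0⁺} G_ε(u, Ω)`. -/
def bmoLiminf {n m : ℕ} (p : ℝ) (D : Set (E n))
    (G : Subgroup (Matrix.specialOrthogonalGroup (Fin n) ℝ))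
    (α : (E n → E m) → Set (E n) → ℝ≥0) (u : E n → E m) (Ω : Set (E n)) : ℝ≥0∞ :=
  liminf (fun ε : ℝ => bmo p D G α ε u Ω) (𝓝[>] 0)

/-- The open unit cube `(-1/2, 1/2)ⁿ`. -/
def unitCube (n : ℕ) : Set (E n) := {x | ∀ i, -(1 / 2 : ℝ) < x i ∧ x i < 1 / 2}

/-- `ψ_α(A) = lim_{ε → 0⁺} G_ε(l^A, (-1/2, 1/2)ⁿ)`. -/
def psi {n m : ℕ} (p : ℝ) (D : Set (E n)) (G : Subgroup (Matrix.specialOrthogonalGroup (Fin n) ℝ))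
    (α : (E n → E m) → Set (E n) → ℝ≥0) (A : Mat m n) : ℝ≥0∞ :=
  limUnder (𝓝[>] (0 : ℝ)) (fun ε : ℝ => bmo p D G α ε (A : E n → E m) (unitCube n))

/-- For every image `D'` of `D`, the functional `α(·, D')` is lower semicontinuous on the Banach
space `L^p(ℝⁿ; ℝᵐ)`. -/
def IsLpLowerSemicontinuous {n m : ℕ} (p : ℝ) (hp : 1 ≤ p) (D : Set (E n))
    (Γ : Subgroup (E n ≃ᵃ[ℝ] E n)) (α : (E n → E m) → Set (E n) → ℝ≥0) : Prop :=
  haveI : Fact (1 ≤ ENNReal.ofReal p) := ⟨ENNReal.one_le_ofReal.2 hp⟩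
  ∀ D' ∈ images D (Γ : Set (E n ≃ᵃ[ℝ] E n)) Set.univ,
    LowerSemicontinuous
      (fun f : Lp (E m) (ENNReal.ofReal p) (volume : Measure (E n)) => α (f : E n → E m) D')

end BMOType

end

/-! Write `N` for the zero set of `psi`. The map `v ↦ α(v, D)^{1/p}` is a seminorm, and `α(A, εRD +
h) = ε^p α(AR, D)` for linear `A`. Rescaling an admissible family in the unit cube and packing `k^n`
copies of it shows that the limit defining `psi` is a supremum (`tendsto_bmo_unitCube`); it is
finite by the gradient bound (`exists_bmo_le`). Moreover `psi A = 0` exactly when `α(AR, D) = 0` for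
all `R ∈ G`, so `N` is an intersection of null spaces of seminorms.

The core is the implication from a finite liminf to `L^p` derivatives. If `α(AR, D) ≠ 0`,
Hahn–Banach for this seminorm (continuous on `L^p`, being lower semicontinuous on a Banach space)
and Riesz representation give `w ∈ L^q` with `|∫_D ⟪v, w⟫|^p ≤ α(v, D)` and `∫_D ⟪ARy, w(y)⟫ dy ≠
0`. The averages `U_ε(x) = ∫_D ⟪u(εRy + x), w(y)⟫ dy` then satisfy `|U_ε(x)|^p ≤ α(u, εRD + x)`.
Splitting the integral over `x` along a lattice coarse enough to separate the copies of `D` bounds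
`∫ |U_ε|^p` by `C ε^p G_ε(u, Ω)` (`exists_lintegral_rpow_average_le`). Constants are killed by `α`,
so `w` has mean zero and `ε⁻¹ U_ε` converges in distributions to `T(∇u)`, where `T(B) = ∫_D ⟪BRy,
w(y)⟫ dy` (`tendsto_integral_average`). Hence `T(∇u) ∈ L^p`.

The functionals `T` with `T(∇u) ∈ L^p` form a subspace whose common kernel lies in `N`; by
finite-dimensional duality it contains every functional vanishing on `N`
(`dualAnnihilator_psiKernel_le`). This covers the coordinates of any linear map that kills `N`: the
projection along `N`, and the identity when `N = 0`. The converse in the last claim is the gradient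
bound summed over disjoint images. -/

/-! ### Duality between `L^p` and `L^q`. -/

section LpDuality

variable {X : Type*} [MeasurableSpace X] {μ : Measure X}

/-- The set function `s ↦ l(1_s)` is a signed measure, countably additive because indicators
converge in `L^q` for `q ≠ ∞`, and it vanishes on `μ`-null sets; `g` is its Radon–Nikodym density.
-/
theorem exists_setIntegral_eq_apply_indicatorConstLp [IsFiniteMeasure μ] {q : ℝ≥0∞}
    [Fact (1 ≤ q)] (hq : q ≠ ∞) (l : Lp ℝ q μ →L[ℝ] ℝ) :
    ∃ g : X → ℝ, Measurable g ∧ Integrable g μ ∧ ∀ (s : Set X) (hs : MeasurableSet s),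
      l (indicatorConstLp q hs (measure_ne_top μ s) 1) = ∫ x in s, g x ∂μ := by
  classical
  let ν : SignedMeasure X :=
    { measureOf' := fun s => if hs : MeasurableSet s then
        l (indicatorConstLp q hs (measure_ne_top μ s) 1) else 0
      empty' := by simp
      not_measurable' := fun s hs => by simp [hs]
      m_iUnion' := by
        intro f hf hd
        simp only [hf, MeasurableSet.iUnion hf, dif_pos]
        refine l.hasSum ?_
        have hsum : ∀ t : Finset ℕ, ∑ i ∈ t, indicatorConstLp q (hf i) (measure_ne_top μ _) (1 : ℝ)
            = indicatorConstLp q (t.measurableSet_biUnion fun i _ => hf i)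
              (measure_ne_top μ _) (1 : ℝ) := by
          intro t
          induction t using Finset.induction_on with
          | empty => simp
          | insert a t ha ih =>
            have hdis : Disjoint (f a) (⋃ i ∈ t, f i) := by
              rw [Set.disjoint_iUnion₂_right]
              exact fun i hi => hd (fun h => ha (h ▸ hi))
            rw [Finset.sum_insert ha, ih]
            simp only [Finset.set_biUnion_insert]
            rw [indicatorConstLp_disjoint_union (hf a) (t.measurableSet_biUnion fun i _ => hf i)
              (measure_ne_top μ _) (measure_ne_top μ _) hdis]
        have := tendsto_indicatorConstLp_set (μ := μ) (c := (1 : ℝ)) (l := atTop)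
          (hs := MeasurableSet.iUnion hf) (hμs := measure_ne_top μ _) (p := q)
          (t := fun t : Finset ℕ => ⋃ i ∈ t, f i)
          (ht := fun t => t.measurableSet_biUnion fun i _ => hf i)
          (hμt := fun t => measure_ne_top μ _) hq ?_
        · simpa only [HasSum, hsum, SummationFilter.unconditional_filter] using this
        -- The symmetric difference between a finite partial union and the full union has measure at
        -- most a tail of a convergent series.
        · have hfin : ∑' i, μ (f i) ≠ ∞ := by
            rw [← measure_iUnion hd hf]; exact measure_ne_top μ _
          refine tendsto_of_tendsto_of_tendsto_of_le_of_le tendsto_const_nhds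
            (ENNReal.tendsto_tsum_compl_atTop_zero hfin) (fun _ => zero_le) fun t => ?_
          refine le_trans (measure_mono ?_) (measure_iUnion_le _)
          intro x hx
          rcases hx with ⟨h1, h2⟩ | ⟨h1, h2⟩
          · simp only [Set.mem_iUnion] at h1 h2
            obtain ⟨i, _, hi⟩ := h1
            exact (h2 ⟨i, hi⟩).elim
          · simp only [Set.mem_iUnion] at h1 h2 ⊢
            obtain ⟨i, hi⟩ := h1
            exact ⟨⟨i, fun h => h2 ⟨i, h, hi⟩⟩, hi⟩ }
  have hν : ∀ (s : Set X) (hs : MeasurableSet s),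
      ν s = l (indicatorConstLp q hs (measure_ne_top μ s) 1) := fun s hs => dif_pos hs
  have hac : ν ≪ᵥ μ.toENNRealVectorMeasure := by
    refine VectorMeasure.AbsolutelyContinuous.mk fun s hs h => ?_
    rw [Measure.toENNRealVectorMeasure_apply_measurable hs] at h
    rw [hν s hs]
    have : indicatorConstLp q hs (measure_ne_top μ s) (1 : ℝ) = 0 := by
      rw [← indicatorConstLp_empty (p := q) (μ := μ) (c := (1 : ℝ))]
      exact (indicatorConstLp_inj hs (measure_ne_top μ s) MeasurableSet.empty (by simp)
        one_ne_zero).2 (ae_eq_empty.2 h)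
    rw [this, map_zero]
  have hrep := (SignedMeasure.absolutelyContinuous_iff_withDensityᵥ_rnDeriv_eq ν μ).1 hac
  refine ⟨ν.rnDeriv μ, SignedMeasure.measurable_rnDeriv ν μ, SignedMeasure.integrable_rnDeriv ν μ, fun s hs => ?_⟩
  rw [← hν s hs, ← withDensityᵥ_apply (SignedMeasure.integrable_rnDeriv ν μ) hs, hrep]

theorem apply_toLp_simpleFunc_eq_integral [IsFiniteMeasure μ] {q : ℝ≥0∞}
    [Fact (1 ≤ q)] (l : Lp ℝ q μ →L[ℝ] ℝ) {g : X → ℝ} (hg : Integrable g μ)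
    (h : ∀ (s : Set X) (hs : MeasurableSet s),
      l (indicatorConstLp q hs (measure_ne_top μ s) 1) = ∫ x in s, g x ∂μ)
    (f : SimpleFunc X ℝ) :
    l ((f.memLp_of_isFiniteMeasure q μ).toLp f) = ∫ x, f x * g x ∂μ := by
  have hint : ∀ f : SimpleFunc X ℝ, Integrable (fun x => f x * g x) μ := fun f => by
    obtain ⟨C, hC⟩ := f.exists_forall_norm_le
    exact hg.bdd_mul f.aestronglyMeasurable (Eventually.of_forall hC)
  induction f using SimpleFunc.induction with
  | const c hs =>
    rename_i s
    have e1 : ((SimpleFunc.piecewise s hs (SimpleFunc.const X c)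
        (SimpleFunc.const X 0)).memLp_of_isFiniteMeasure q μ).toLp _
        = c • indicatorConstLp q hs (measure_ne_top μ s) (1 : ℝ) := by
      rw [indicatorConstLp, ← MemLp.toLp_const_smul]
      refine MemLp.toLp_congr _ _ (Eventually.of_forall fun x => ?_)
      by_cases hx : x ∈ s <;> simp [hx]
    rw [e1, map_smul, h s hs, smul_eq_mul, ← integral_const_mul, ← integral_indicator hs]
    refine integral_congr_ae (Eventually.of_forall fun x => ?_)
    by_cases hx : x ∈ s <;> simp [hx]
  | add hfg hf hg' =>
    rename_i f₁ f₂
    have e1 : ((f₁ + f₂).memLp_of_isFiniteMeasure q μ).toLp _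
        = (f₁.memLp_of_isFiniteMeasure q μ).toLp _ + (f₂.memLp_of_isFiniteMeasure q μ).toLp _ := by
      rw [← MemLp.toLp_add]; rfl
    rw [e1, map_add, hf, hg', ← integral_add (hint f₁) (hint f₂)]
    refine integral_congr_ae (Eventually.of_forall fun x => ?_)
    simp [add_mul]


/-- Testing `l` on `S^{p-1} sgn g`, with `S` a simple function below `|g|`, gives `J ≤ ‖l‖ J^{1/q}`
for `J = ∫ S^p`. Since `J` is finite it may be divided out, so `J ≤ ‖l‖^p`, and monotone convergence
transfers the bound to `g`. -/
theorem memLp_of_setIntegral_eq_apply_indicatorConstLp [IsFiniteMeasure μ] {p q : ℝ}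
    (hpq : p.HolderConjugate q) [Fact (1 ≤ ENNReal.ofReal q)]
    (l : Lp ℝ (ENNReal.ofReal q) μ →L[ℝ] ℝ) {g : X → ℝ} (hgm : Measurable g)
    (hg : Integrable g μ)
    (h : ∀ (s : Set X) (hs : MeasurableSet s),
      l (indicatorConstLp (ENNReal.ofReal q) hs (measure_ne_top μ s) 1) = ∫ x in s, g x ∂μ) :
    MemLp g (ENNReal.ofReal p) μ := by
  have hp := hpq.pos
  have hq := hpq.symm.pos
  set S : ℕ → SimpleFunc X ℝ≥0∞ := fun k => SimpleFunc.eapprox (fun x => ‖g x‖ₑ) k with hS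
  have hSle : ∀ k x, S k x ≤ ‖g x‖ₑ := fun k x => by
    rw [← SimpleFunc.iSup_eapprox_apply (f := fun x => ‖g x‖ₑ) hgm.enorm x]
    exact le_iSup (fun k => SimpleFunc.eapprox (fun x => ‖g x‖ₑ) k x) k
  have hStop : ∀ k x, S k x ≠ ∞ := fun k x => (SimpleFunc.eapprox_lt_top _ k x).ne
  have hsgn : MeasurableSet {x | 0 ≤ g x} := measurableSet_le measurable_const hgm
  -- The extremal function of Hölder's inequality, truncated so that it stays simple: `|f k|^q = (S
  -- k)^p`.
  let f : ℕ → SimpleFunc X ℝ := fun k => (S k).map (fun t => t.toReal ^ (p - 1)) *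
    SimpleFunc.piecewise _ hsgn (SimpleFunc.const X 1) (SimpleFunc.const X (-1))
  have hfe : ∀ k x, ‖f k x‖ₑ = S k x ^ (p - 1) := fun k x => by
    have : ‖f k x‖ = (S k x).toReal ^ (p - 1) := by
      by_cases hx : 0 ≤ g x <;> simp [f, hx, abs_of_nonneg (Real.rpow_nonneg _ _)]
    rw [← ofReal_norm, this, ENNReal.toReal_rpow, ENNReal.ofReal_toReal]
    exact ENNReal.rpow_ne_top_of_nonneg hpq.sub_one_pos.le (hStop k x)
  have hfg : ∀ k x, (S k x ^ p).toReal ≤ f k x * g x := fun k x => by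
    have e : f k x * g x = (S k x).toReal ^ (p - 1) * |g x| := by
      by_cases hx : 0 ≤ g x
      · simp [f, hx, abs_of_nonneg hx]
      · simp [f, hx, abs_of_neg (not_le.1 hx)]
    have e2 : (S k x).toReal ≤ |g x| := by
      have := ENNReal.toReal_mono (by simp) (hSle k x)
      simpa using this
    rw [e, ← ENNReal.toReal_rpow]
    calc (S k x).toReal ^ p = (S k x).toReal ^ (p - 1) * (S k x).toReal := by
          rw [← Real.rpow_add_one' ENNReal.toReal_nonneg (by linarith)]; simp
      _ ≤ _ := by gcongr
  have hSbd : ∀ k, ∃ C : ℝ≥0, ∀ x, S k x ≤ C := fun k => by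
    obtain ⟨C, hC⟩ := ((S k).map ENNReal.toNNReal).exists_forall_le
    refine ⟨C, fun x => ?_⟩
    rw [← ENNReal.coe_toNNReal (hStop k x), ENNReal.coe_le_coe]
    exact hC x
  have hJtop : ∀ k, ∫⁻ x, S k x ^ p ∂μ ≠ ∞ := fun k => by
    obtain ⟨C, hC⟩ := hSbd k
    refine ne_top_of_le_ne_top (b := ∫⁻ _, (C : ℝ≥0∞) ^ p ∂μ) ?_ (lintegral_mono fun x => ?_)
    · rw [lintegral_const]
      exact ENNReal.mul_ne_top (ENNReal.rpow_ne_top_of_nonneg hp.le (by simp)) (measure_ne_top _ _)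
    · exact ENNReal.rpow_le_rpow (hC x) hp.le
  have hint : ∀ f : SimpleFunc X ℝ, Integrable (fun x => f x * g x) μ := fun f => by
    obtain ⟨C, hC⟩ := f.exists_forall_norm_le
    exact hg.bdd_mul f.aestronglyMeasurable (Eventually.of_forall hC)
  have hmeas : ∀ k, Measurable fun x => S k x ^ p := fun k => (S k).measurable.pow_const p
  have key : ∀ k, ∫⁻ x, S k x ^ p ∂μ ≤ ENNReal.ofReal (‖l‖ ^ p) := fun k => by
    set J := ∫⁻ x, S k x ^ p ∂μ with hJ
    have h1 : J.toReal ≤ ∫ x, f k x * g x ∂μ := by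
      rw [hJ, ← integral_toReal (hmeas k).aemeasurable
        (ae_of_all _ fun x => (ENNReal.rpow_lt_top_of_nonneg hp.le (hStop k x)))]
      exact integral_mono (integrable_toReal_of_lintegral_ne_top (hmeas k).aemeasurable (hJtop k))
        (hint _) (hfg k)
    have h2 : eLpNorm (f k) (ENNReal.ofReal q) μ = J ^ (1 / q) := by
      rw [eLpNorm_eq_lintegral_rpow_enorm_toReal (by simpa using hq) (by simp),
        ENNReal.toReal_ofReal hq.le]
      congr 1
      refine lintegral_congr fun x => ?_
      rw [hfe, ← ENNReal.rpow_mul, hpq.sub_one_mul_conj]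
    have h3 : J.toReal ≤ ‖l‖ * J.toReal ^ (1 / q) := by
      refine h1.trans ?_
      rw [← apply_toLp_simpleFunc_eq_integral l hg h]
      refine (le_abs_self _).trans ((l.le_opNorm _).trans ?_)
      rw [Lp.norm_toLp, h2, ENNReal.toReal_rpow]
    have hJ0 : 0 ≤ J.toReal := ENNReal.toReal_nonneg
    rw [← ENNReal.ofReal_toReal (show J ≠ ∞ from hJtop k)]
    refine ENNReal.ofReal_le_ofReal ?_
    rcases hJ0.eq_or_lt with h0 | h0
    · rw [← h0]; positivity
    · have h4 : J.toReal ^ (1 / p) ≤ ‖l‖ := by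
        have : J.toReal = J.toReal ^ (1 / p) * J.toReal ^ (1 / q) := by
          rw [← Real.rpow_add h0, one_div, one_div, hpq.inv_add_inv_eq_one, Real.rpow_one]
        rw [this] at h3
        exact le_of_mul_le_mul_right (by rwa [← this] at h3 ⊢) (Real.rpow_pos_of_pos h0 _)
      calc J.toReal = (J.toReal ^ (1 / p)) ^ p := by
            rw [← Real.rpow_mul hJ0, one_div, inv_mul_cancel₀ hp.ne', Real.rpow_one]
        _ ≤ _ := by gcongr
  refine ⟨hgm.aestronglyMeasurable, ?_⟩
  rw [eLpNorm_lt_top_iff_lintegral_rpow_enorm_lt_top (by simpa using hp) (by simp),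
    ENNReal.toReal_ofReal hp.le]
  refine lt_of_le_of_lt ?_ (ENNReal.ofReal_lt_top (r := ‖l‖ ^ p))
  have hsup : ∀ x, ‖g x‖ₑ ^ p = ⨆ k, S k x ^ p := fun x => by
    rw [← SimpleFunc.iSup_eapprox_apply (f := fun x => ‖g x‖ₑ) hgm.enorm x]
    exact (ENNReal.orderIsoRpow p hp).map_iSup _
  simp_rw [hsup]
  rw [lintegral_iSup hmeas]
  · exact iSup_le key
  · intro i j hij x
    exact ENNReal.rpow_le_rpow (SimpleFunc.monotone_eapprox _ hij x) hp.le

/-- Once `g ∈ L^p`, both sides are continuous in `f` and agree on indicators, which span a dense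
subspace. -/
theorem exists_memLp_forall_apply_eq_integral_of_isFiniteMeasure [IsFiniteMeasure μ] {p q : ℝ}
    (hpq : p.HolderConjugate q) [Fact (1 ≤ ENNReal.ofReal q)]
    (l : Lp ℝ (ENNReal.ofReal q) μ →L[ℝ] ℝ) :
    ∃ g : X → ℝ, MemLp g (ENNReal.ofReal p) μ ∧
      ∀ f : Lp ℝ (ENNReal.ofReal q) μ, l f = ∫ x, f x * g x ∂μ := by
  obtain ⟨g, hgm, hg, h⟩ := exists_setIntegral_eq_apply_indicatorConstLp (by simp) l
  have hgp := memLp_of_setIntegral_eq_apply_indicatorConstLp hpq l hgm hg h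
  have : Fact (1 ≤ ENNReal.ofReal p) := ⟨ENNReal.one_le_ofReal.2 hpq.lt.le⟩
  have : ENNReal.HolderConjugate (ENNReal.ofReal q) (ENNReal.ofReal p) :=
    hpq.symm.ennrealOfReal
  refine ⟨g, hgp, fun f => ?_⟩
  set B := (ContinuousLinearMap.mul ℝ ℝ).lpPairing μ (ENNReal.ofReal q) (ENNReal.ofReal p)
  have hB : ∀ f : Lp ℝ (ENNReal.ofReal q) μ, B f (hgp.toLp g) = ∫ x, f x * g x ∂μ := fun f => by
    rw [ContinuousLinearMap.lpPairing_eq_integral]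
    refine integral_congr_ae ?_
    filter_upwards [hgp.coeFn_toLp] with x hx
    simp [hx]
  rw [← hB]
  refine Lp.induction ENNReal.ofReal_ne_top (motive := fun f => l f = B f (hgp.toLp g))
    ?_ ?_ ?_ f
  · intro c s hs hμs
    rw [hB, Lp.simpleFunc.coe_indicatorConst]
    have e : indicatorConstLp (ENNReal.ofReal q) hs hμs.ne c =
        c • indicatorConstLp (ENNReal.ofReal q) hs hμs.ne (1 : ℝ) := by
      rw [indicatorConstLp, indicatorConstLp, ← MemLp.toLp_const_smul]
      refine MemLp.toLp_congr _ _ (Eventually.of_forall fun x => ?_)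
      by_cases hx : x ∈ s <;> simp [hx]
    rw [e, map_smul, h s hs, smul_eq_mul, ← integral_const_mul, ← integral_indicator hs]
    refine integral_congr_ae ?_
    filter_upwards [Lp.coeFn_smul c (indicatorConstLp (ENNReal.ofReal q) hs hμs.ne (1 : ℝ)),
      indicatorConstLp_coeFn (p := ENNReal.ofReal q) (hs := hs) (hμs := hμs.ne) (c := (1 : ℝ))]
      with x h1 h2
    rw [h1, Pi.smul_apply, h2]
    by_cases hx : x ∈ s <;> simp [hx]
  · intro f₁ f₂ hf hg _ h1 h2
    rw [map_add, h1, h2, map_add]; rfl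
  · exact isClosed_eq l.continuous (B.flip (hgp.toLp g)).continuous


/-- Multiplication by `w^{1/q}` preserves norms from `L^q(wμ)` to `L^q(μ)`; this reduces the
`σ`-finite case of Riesz representation to a finite measure. -/
theorem eLpNorm_mul_rpow_eq_eLpNorm_withDensity {q : ℝ} (hq : 0 < q) {w : X → ℝ≥0}
    (hw : Measurable w) (f : X → ℝ) :
    eLpNorm (fun x => f x * (w x : ℝ) ^ (1 / q)) (ENNReal.ofReal q) μ =
      eLpNorm f (ENNReal.ofReal q) (μ.withDensity fun x => (w x : ℝ≥0∞)) := by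
  rw [eLpNorm_eq_lintegral_rpow_enorm_toReal (by simpa using hq) (by simp),
    eLpNorm_eq_lintegral_rpow_enorm_toReal (by simpa using hq) (by simp),
    ENNReal.toReal_ofReal hq.le,
    lintegral_withDensity_eq_lintegral_mul_non_measurable _ hw.coe_nnreal_ennreal (by simp)]
  congr 1
  refine lintegral_congr fun x => ?_
  have : ‖(w x : ℝ) ^ (1 / q)‖ₑ = (w x : ℝ≥0∞) ^ (1 / q) := by
    rw [← ofReal_norm, Real.norm_of_nonneg (by positivity),
      ← ENNReal.ofReal_rpow_of_nonneg (by positivity) (by positivity), ENNReal.ofReal_coe_nnreal]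
  rw [enorm_mul, ENNReal.mul_rpow_of_nonneg _ _ hq.le, this, ← ENNReal.rpow_mul,
    one_div_mul_cancel hq.ne', ENNReal.rpow_one, Pi.mul_apply, mul_comm]

/-- **Riesz representation theorem** for the dual of `L^q` over a `σ`-finite measure. -/
theorem exists_memLp_forall_apply_eq_integral [SigmaFinite μ] {p q : ℝ}
    (hpq : p.HolderConjugate q) [Fact (1 ≤ ENNReal.ofReal q)]
    (l : Lp ℝ (ENNReal.ofReal q) μ →L[ℝ] ℝ) :
    ∃ g : X → ℝ, MemLp g (ENNReal.ofReal p) μ ∧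
      ∀ f : Lp ℝ (ENNReal.ofReal q) μ, l f = ∫ x, f x * g x ∂μ := by
  have hp := hpq.pos
  have hq := hpq.symm.pos
  -- A positive integrable weight: `wμ` is finite and has the same null sets as `μ`.
  obtain ⟨w, hw0, hw, hwlt⟩ := exists_pos_lintegral_lt_of_sigmaFinite μ one_ne_zero
  set μ' := μ.withDensity fun x => (w x : ℝ≥0∞) with hμ'
  have : IsFiniteMeasure μ' := isFiniteMeasure_withDensity (hwlt.trans (by simp)).ne
  have hac : μ ≪ μ' := withDensity_absolutelyContinuous' hw.coe_nnreal_ennreal.aemeasurable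
    (ae_of_all _ fun x => by simpa using (hw0 x).ne')
  have hac' : μ' ≪ μ := withDensity_absolutelyContinuous _ _
  have hwr : ∀ r : ℝ, Measurable fun x => (w x : ℝ) ^ r := fun r =>
    hw.coe_nnreal_real.pow_const r
  have hwpos : ∀ x, 0 < (w x : ℝ) := fun x => hw0 x
  have hmem : ∀ f : Lp ℝ (ENNReal.ofReal q) μ',
      MemLp (fun x => f x * (w x : ℝ) ^ (1 / q)) (ENNReal.ofReal q) μ := fun f => by
    refine ⟨((Lp.memLp f).1.mono_ac hac).mul (hwr _).aestronglyMeasurable, ?_⟩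
    rw [eLpNorm_mul_rpow_eq_eLpNorm_withDensity hq hw]
    exact (Lp.memLp f).2
  let J : Lp ℝ (ENNReal.ofReal q) μ' →ₗ[ℝ] Lp ℝ (ENNReal.ofReal q) μ :=
    { toFun := fun f => (hmem f).toLp _
      map_add' := fun f g => by
        rw [← MemLp.toLp_add]
        refine MemLp.toLp_congr _ _ ?_
        filter_upwards [hac.ae_le (Lp.coeFn_add f g)] with x hx
        rw [hx]
        simp [add_mul]
      map_smul' := fun c f => by
        rw [RingHom.id_apply, ← MemLp.toLp_const_smul]
        refine MemLp.toLp_congr _ _ ?_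
        filter_upwards [hac.ae_le (Lp.coeFn_smul c f)] with x hx
        rw [hx]
        simp [mul_assoc] }
  have hJ : ∀ f, ‖J f‖ ≤ 1 * ‖f‖ := fun f => by
    rw [one_mul]
    change ‖(hmem f).toLp _‖ ≤ _
    rw [Lp.norm_toLp, eLpNorm_mul_rpow_eq_eLpNorm_withDensity hq hw, Lp.norm_def]
  obtain ⟨h, hh, hrep⟩ := exists_memLp_forall_apply_eq_integral_of_isFiniteMeasure hpq
    (l.comp (J.mkContinuous 1 hJ))
  -- The density is dictated by `w · w^{-1/q} = w^{1/p}`: one factor `w` comes from the measure, the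
  -- other from inverting `J`.
  refine ⟨fun x => h x * (w x : ℝ) ^ (1 / p), ⟨(hh.1.mono_ac hac).mul
    (hwr _).aestronglyMeasurable, ?_⟩, fun F => ?_⟩
  · rw [eLpNorm_mul_rpow_eq_eLpNorm_withDensity hp hw]
    exact hh.2
  have hcancel : ∀ x, F x * (w x : ℝ) ^ (-(1 / q)) * (w x : ℝ) ^ (1 / q) = F x := fun x => by
    rw [mul_assoc, ← Real.rpow_add (hwpos x), neg_add_cancel, Real.rpow_zero, mul_one]
  have hF : MemLp (fun x => F x * (w x : ℝ) ^ (-(1 / q))) (ENNReal.ofReal q) μ' := by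
    refine ⟨((Lp.memLp F).1.mul (hwr _).aestronglyMeasurable).mono_ac hac', ?_⟩
    rw [← eLpNorm_mul_rpow_eq_eLpNorm_withDensity hq hw]
    simp_rw [hcancel]
    exact (Lp.memLp F).2
  have hJF : J (hF.toLp _) = F := by
    change (hmem (hF.toLp _)).toLp _ = F
    conv_rhs => rw [← Lp.toLp_coeFn F (Lp.memLp F)]
    refine MemLp.toLp_congr _ _ ?_
    filter_upwards [hac.ae_le hF.coeFn_toLp] with x hx
    rw [hx, hcancel]
  have := hrep (hF.toLp _)
  rw [ContinuousLinearMap.comp_apply, LinearMap.mkContinuous_apply, hJF] at this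
  rw [this]
  have e : ∫ x, (hF.toLp _) x * h x ∂μ' =
      ∫ x, (F x * (w x : ℝ) ^ (-(1 / q))) * h x ∂μ' := by
    refine integral_congr_ae ?_
    filter_upwards [hF.coeFn_toLp] with x hx
    rw [hx]
  rw [e, integral_withDensity_eq_integral_smul hw]
  refine integral_congr_ae (Eventually.of_forall fun x => ?_)
  have hexp : (w x : ℝ) * (w x : ℝ) ^ (-(1 / q)) = (w x : ℝ) ^ (1 / p) := by
    rw [← Real.rpow_one_add' (hwpos x).le]
    · congr 1
      have := hpq.inv_add_inv_eq_one
      rw [one_div, one_div]; linarith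
    · have := hpq.inv_add_inv_eq_one
      have := inv_pos.2 hp
      rw [one_div]; linarith
  simp only [NNReal.smul_def, smul_eq_mul]
  rw [← hexp]; ring

open RealInnerProductSpace in
/-- **Riesz representation theorem** for the dual of the space `L^q` of vector-valued functions. -/
theorem exists_memLp_forall_apply_eq_integral_inner [SigmaFinite μ] {ι : Type*} [Fintype ι]
    {p q : ℝ} (hpq : p.HolderConjugate q) [Fact (1 ≤ ENNReal.ofReal q)]
    (l : Lp (EuclideanSpace ℝ ι) (ENNReal.ofReal q) μ →L[ℝ] ℝ) :
    ∃ g : X → EuclideanSpace ℝ ι, MemLp g (ENNReal.ofReal p) μ ∧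
      ∀ f : Lp (EuclideanSpace ℝ ι) (ENNReal.ofReal q) μ, l f = ∫ x, ⟪f x, g x⟫ ∂μ := by
  classical
  have : Fact (1 ≤ ENNReal.ofReal p) := ⟨ENNReal.one_le_ofReal.2 hpq.lt.le⟩
  have : ENNReal.HolderTriple (ENNReal.ofReal q) (ENNReal.ofReal p) 1 :=
    hpq.symm.ennrealOfReal
  let e : ι → EuclideanSpace ℝ ι := fun k => EuclideanSpace.single k 1
  let I : ι → ℝ →L[ℝ] EuclideanSpace ℝ ι := fun k => ContinuousLinearMap.toSpanSingleton ℝ (e k)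
  choose g hg hrep using fun k => exists_memLp_forall_apply_eq_integral hpq
    (l.comp ((I k).compLpL (ENNReal.ofReal q) μ))
  refine ⟨fun x => ∑ k, g k x • e k, ?_, fun f => ?_⟩
  · exact memLp_finsetSum _ fun k _ => ((I k).comp_memLp' (hg k)).congr_norm
      (((I k).comp_memLp' (hg k)).1) (by simp [I]) 
  let f' : ι → Lp ℝ (ENNReal.ofReal q) μ := fun k => (EuclideanSpace.proj (𝕜 := ℝ) k).compLp f
  have hf' : ∀ k, ∀ᵐ x ∂μ, f' k x = f x k := fun k => by
    filter_upwards [(EuclideanSpace.proj (𝕜 := ℝ) k).coeFn_compLp f] with x hx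
    simp [f', hx]
  have hf : f = ∑ k, (I k).compLpL (ENNReal.ofReal q) μ (f' k) := by
    refine Lp.ext ?_
    filter_upwards [Lp.coeFn_finsetSum Finset.univ
      (fun k => (I k).compLpL (ENNReal.ofReal q) μ (f' k)), ae_all_iff.2 hf',
      ae_all_iff.2 fun k => (I k).coeFn_compLpL (f' k)] with x h1 h2 h3
    rw [h1]
    simp only [Finset.sum_apply, h3, h2]
    ext i
    simp [I, e, Pi.single_apply]
  have hl : l f = ∑ k, ∫ x, f' k x * g k x ∂μ := by
    conv_lhs => rw [hf, map_sum]
    exact Finset.sum_congr rfl fun k _ => hrep k (f' k)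
  rw [hl, ← integral_finsetSum]
  · refine integral_congr_ae ?_
    filter_upwards [ae_all_iff.2 hf'] with x hx
    simp [hx, inner_sum, inner_smul_right, e, mul_comm, EuclideanSpace.inner_single_right]
  · exact fun k _ => MemLp.integrable_mul (Lp.memLp _) (hg k)

end LpDuality

/-- The bound forces `ker J ≤ ker Λ`, so `Λ` descends to the range of `J`, where Hahn–Banach extends
it. -/
theorem exists_continuousLinearMap_forall_apply_eq_of_abs_le {V X : Type*} [AddCommGroup V]
    [Module ℝ V] [NormedAddCommGroup X] [NormedSpace ℝ X] (J : V →ₗ[ℝ] X) (Λ : V →ₗ[ℝ] ℝ)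
    {C : ℝ} (hC : 0 ≤ C) (h : ∀ v, |Λ v| ≤ C * ‖J v‖) :
    ∃ l : X →L[ℝ] ℝ, ∀ v, l (J v) = Λ v := by
  have hker : LinearMap.ker J ≤ LinearMap.ker Λ := fun v hv => by
    have := h v
    rw [LinearMap.mem_ker.1 hv, norm_zero, mul_zero] at this
    exact abs_nonpos_iff.1 this
  let f : LinearMap.range J →ₗ[ℝ] ℝ :=
    (LinearMap.ker J).liftQ Λ hker ∘ₗ J.quotKerEquivRange.symm.toLinearMap
  have hf : ∀ v, f ⟨J v, LinearMap.mem_range_self J v⟩ = Λ v := fun v => by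
    have : J.quotKerEquivRange.symm ⟨J v, LinearMap.mem_range_self J v⟩ =
        (LinearMap.ker J).mkQ v := by
      rw [LinearEquiv.symm_apply_eq]; rfl
    simp only [f, LinearMap.comp_apply, LinearEquiv.coe_coe, this]
    simp
  have hle : ∀ x : LinearMap.range J, f x ≤ (C.toNNReal • normSeminorm ℝ X) (x : X) := by
    rintro ⟨_, v, rfl⟩
    rw [hf]
    refine (le_abs_self _).trans ((h v).trans_eq ?_)
    rw [smul_apply, NNReal.smul_def, Real.coe_toNNReal C hC]; rfl
  obtain ⟨l, hl, -⟩ := Module.Dual.exists_continuous_extension_of_le_seminorm_real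
    (LinearMap.range J) f (continuous_norm.const_smul C.toNNReal) hle
  exact ⟨l, fun v => (hl ⟨J v, LinearMap.mem_range_self J v⟩).trans (hf v)⟩

/-! ### Core functionals as seminorms. -/

noncomputable section

namespace BMOType

open RealInnerProductSpace

variable {n m : ℕ} {p : ℝ}

theorem MemLpLoc.add {u v : E n → E m} (hu : MemLpLoc p u) (hv : MemLpLoc p v) :
    MemLpLoc p (u + v) := fun K hK => (hu K hK).add (hv K hK)

theorem MemLpLoc.const_smul {u : E n → E m} (hu : MemLpLoc p u) (c : ℝ) :
    MemLpLoc p (c • u) := fun K hK => (hu K hK).const_smul c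

theorem memLpLoc_of_continuous {u : E n → E m} (hu : Continuous u) : MemLpLoc p u :=
  fun K hK => by
    have : IsFiniteMeasure (volume.restrict K) := isFiniteMeasure_restrict.2 hK.measure_lt_top.ne
    obtain ⟨C, hC⟩ := hK.exists_bound_of_continuousOn hu.continuousOn
    exact MemLp.of_bound hu.aestronglyMeasurable C
      ((ae_restrict_iff' hK.measurableSet).2 (ae_of_all _ hC))

theorem memLpLoc_of_memLp {u : E n → E m} (hu : MemLp u (ENNReal.ofReal p) volume) :
    MemLpLoc p u := fun _ _ => hu.restrict _

theorem MemLpLoc.memLp_restrict {u : E n → E m} (hu : MemLpLoc p u) {s : Set (E n)}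
    (hs : Bornology.IsBounded s) : MemLp u (ENNReal.ofReal p) (volume.restrict s) :=
  (hu _ hs.isCompact_closure).mono_measure (Measure.restrict_mono subset_closure le_rfl)

theorem self_mem_images (D : Set (E n)) (Γ : Subgroup (E n ≃ᵃ[ℝ] E n)) :
    D ∈ images D (Γ : Set (E n ≃ᵃ[ℝ] E n)) Set.univ :=
  ⟨⟨1, Γ.one_mem, by simp [AffineEquiv.one_def]⟩, Set.subset_univ _⟩

namespace IsCoreFunctional

variable {D : Set (E n)} {Γ : Subgroup (E n ≃ᵃ[ℝ] E n)} {α : (E n → E m) → Set (E n) → ℝ≥0}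

theorem apply_image (hα : IsCoreFunctional p D Γ α) {u : E n → E m} (hu : MemLpLoc p u)
    {F : E n ≃ᵃ[ℝ] E n} (hF : F ∈ Γ) : α u (F '' D) = α (u ∘ F) D :=
  (hα.change_var D (self_mem_images D Γ) u hu F hF).symm

theorem apply_zero (hα : IsCoreFunctional p D Γ α) (hp : 1 < p) : α 0 D = 0 := by
  have := hα.homogeneous D (self_mem_images D Γ) (0 : E n → E m)
    (memLpLoc_of_continuous continuous_const) 0
  rw [smul_zero, abs_zero, Real.zero_rpow (by linarith), zero_mul] at this
  exact_mod_cast this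

theorem apply_const (hα : IsCoreFunctional p D Γ α) (hp : 1 < p) (c : E m) :
    α (fun _ => c) D = 0 := by
  have := hα.trans_inv D (self_mem_images D Γ) (0 : E n → E m)
    (memLpLoc_of_continuous continuous_const) c
  rw [hα.apply_zero hp] at this
  simpa using this

/-- The seminorm `v ↦ α(v, D)^{1/p}`. -/
def coreNorm (p : ℝ) (D : Set (E n)) (α : (E n → E m) → Set (E n) → ℝ≥0) (v : E n → E m) : ℝ :=
  (α v D : ℝ) ^ (1 / p)

theorem coreNorm_nonneg (v : E n → E m) : 0 ≤ coreNorm p D α v := by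
  unfold coreNorm; positivity

theorem coreNorm_rpow (hp : 1 < p) (v : E n → E m) : coreNorm p D α v ^ p = α v D := by
  rw [coreNorm, ← Real.rpow_mul (by positivity), one_div_mul_cancel (by linarith), Real.rpow_one]

theorem coreNorm_smul (hα : IsCoreFunctional p D Γ α) (hp : 1 < p) {v : E n → E m}
    (hv : MemLpLoc p v) (t : ℝ) : coreNorm p D α (t • v) = |t| * coreNorm p D α v := by
  rw [coreNorm, hα.homogeneous D (self_mem_images D Γ) v hv, Real.mul_rpow (by positivity)
    (by positivity), ← Real.rpow_mul (abs_nonneg t), mul_one_div_cancel (by linarith),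
    Real.rpow_one, coreNorm]

/-- By `p`-homogeneity this is the gauge of the set `{α(·, D) ≤ 1}`, which is convex. The triangle
inequality is convexity applied to `u/a` and `v/b` with weights `a/(a+b)` and `b/(a+b)`. -/
theorem coreNorm_add_le (hα : IsCoreFunctional p D Γ α) (hp : 1 < p) {u v : E n → E m}
    (hu : MemLpLoc p u) (hv : MemLpLoc p v) :
    coreNorm p D α (u + v) ≤ coreNorm p D α u + coreNorm p D α v := by
  have hp0 : 0 < p := by linarith
  have hle : ∀ w : E n → E m, MemLpLoc p w → ∀ a : ℝ, 0 < a → coreNorm p D α w ≤ a →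
      (α (a⁻¹ • w) D : ℝ) ≤ 1 := fun w hw a ha haw => by
    rw [← coreNorm_rpow hp, coreNorm_smul hα hp hw, abs_of_pos (inv_pos.2 ha)]
    refine Real.rpow_le_one (mul_nonneg (inv_pos.2 ha).le (coreNorm_nonneg _)) ?_ hp0.le
    rw [inv_mul_le_iff₀ ha, mul_one]
    exact haw
  refine le_of_forall_pos_le_add fun s hs => ?_
  -- The slack `s / 2` keeps `a` and `b` positive even where the seminorm vanishes.
  set a := coreNorm p D α u + s / 2 with ha
  set b := coreNorm p D α v + s / 2 with hb
  have ha0 : 0 < a := add_pos_of_nonneg_of_pos (coreNorm_nonneg _) (by linarith)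
  have hb0 : 0 < b := add_pos_of_nonneg_of_pos (coreNorm_nonneg _) (by linarith)
  have hab : 0 < a + b := add_pos ha0 hb0
  have h1 := hle u hu a ha0 (by linarith)
  have h2 := hle v hv b hb0 (by linarith)
  have ht1 : a / (a + b) ≤ 1 := (div_le_one hab).2 (by linarith)
  have h3 := hα.convex D (self_mem_images D Γ) (a⁻¹ • u) (b⁻¹ • v) (hu.const_smul _)
    (hv.const_smul _) (a / (a + b)) (by positivity) ht1
  have e : (a / (a + b)) • a⁻¹ • u + (1 - a / (a + b)) • b⁻¹ • v = (a + b)⁻¹ • (u + v) := by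
    rw [smul_smul, smul_smul, smul_add]
    congr 2 <;> field_simp
    ring
  rw [e] at h3
  have h4 : (α ((a + b)⁻¹ • (u + v)) D : ℝ) ≤ 1 := by
    refine h3.trans ?_
    nlinarith [div_nonneg ha0.le hab.le]
  have h5 := coreNorm_smul hα hp (hu.add hv) (a + b)⁻¹
  have h6 : coreNorm p D α ((a + b)⁻¹ • (u + v)) ≤ 1 :=
    Real.rpow_le_one (by positivity) h4 (by positivity)
  rw [h5, abs_of_pos (inv_pos.2 hab), inv_mul_le_iff₀ hab, mul_one] at h6
  linarith

theorem coreNorm_congr (hα : IsCoreFunctional p D Γ α) {u v : E n → E m} (hu : MemLpLoc p u)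
    (hv : MemLpLoc p v) (h : u =ᵐ[volume.restrict D] v) :
    coreNorm p D α u = coreNorm p D α v := by
  rw [coreNorm, hα.ext_indep D (self_mem_images D Γ) u v hu hv h, coreNorm]

/-- The seminorm `f ↦ α(f, D)^{1/p}` on `L^p(ℝⁿ; ℝᵐ)`. -/
def seminormLp (hα : IsCoreFunctional p D Γ α) (hp : 1 < p) [Fact (1 ≤ ENNReal.ofReal p)] :
    Seminorm ℝ (Lp (E m) (ENNReal.ofReal p) (volume : Measure (E n))) :=
  Seminorm.of (fun f => coreNorm p D α f)
    (fun f g => by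
      have hf := memLpLoc_of_memLp (Lp.memLp f)
      have hg := memLpLoc_of_memLp (Lp.memLp g)
      rw [hα.coreNorm_congr (memLpLoc_of_memLp (Lp.memLp (f + g))) (hf.add hg)
        (ae_restrict_of_ae (Lp.coeFn_add f g))]
      exact hα.coreNorm_add_le hp hf hg)
    (fun c f => by
      have hf := memLpLoc_of_memLp (Lp.memLp f)
      rw [hα.coreNorm_congr (memLpLoc_of_memLp (Lp.memLp (c • f))) (hf.const_smul c)
        (ae_restrict_of_ae (Lp.coeFn_smul c f)), hα.coreNorm_smul hp hf, Real.norm_eq_abs])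

theorem continuous_seminormLp (hα : IsCoreFunctional p D Γ α) (hp : 1 < p)
    (hlsc : IsLpLowerSemicontinuous p hp.le D Γ α) [Fact (1 ≤ ENNReal.ofReal p)] :
    Continuous (hα.seminormLp hp) := by
  refine Seminorm.continuous_of_lowerSemicontinuous _ ?_
  have hmono : Monotone fun x : ℝ≥0 => (x : ℝ) ^ (1 / p) := fun x y hxy =>
    Real.rpow_le_rpow x.2 hxy (by positivity)
  have hcont : Continuous fun x : ℝ≥0 => (x : ℝ) ^ (1 / p) :=
    NNReal.continuous_coe.rpow_const fun _ => Or.inr (by positivity)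
  exact hcont.comp_lowerSemicontinuous (hlsc D (self_mem_images D Γ)) hmono

/-- A core functional that does not vanish at `v₀` is bounded below by the `p`-th power of a
functional `v ↦ ∫_D ⟪v, w⟫` that does not vanish at `v₀`. -/
theorem exists_memLp_rpow_abs_integral_inner_le (hα : IsCoreFunctional p D Γ α) (hp : 1 < p)
    (hlsc : IsLpLowerSemicontinuous p hp.le D Γ α) (hD : MeasurableSet D)
    (hDb : Bornology.IsBounded D) {q : ℝ} (hpq : p.HolderConjugate q)
    {v₀ : E n → E m} (hv₀ : MemLpLoc p v₀) (h0 : α v₀ D ≠ 0) :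
    ∃ w : E n → E m, MemLp w (ENNReal.ofReal q) volume ∧
      (∀ v, MemLpLoc p v → |∫ x in D, ⟪v x, w x⟫| ^ p ≤ α v D) ∧
      ∫ x in D, ⟪v₀ x, w x⟫ ≠ 0 := by
  have : Fact (1 ≤ ENNReal.ofReal p) := ⟨ENNReal.one_le_ofReal.2 hp.le⟩
  have hmem : ∀ v : E n → E m, MemLpLoc p v → MemLp (D.indicator v) (ENNReal.ofReal p) volume :=
    fun v hv => (memLp_indicator_iff_restrict hD).2 (hv.memLp_restrict hDb)
  set N := hα.seminormLp hp with hN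
  have hNv : ∀ v (hv : MemLpLoc p v), N ((hmem v hv).toLp _) = coreNorm p D α v := fun v hv => by
    refine hα.coreNorm_congr (memLpLoc_of_memLp (Lp.memLp _)) hv ?_
    filter_upwards [ae_restrict_of_ae (hmem v hv).coeFn_toLp, ae_restrict_mem hD] with x h1 h2
    rw [h1, Set.indicator_of_mem h2]
  set f₀ := (hmem v₀ hv₀).toLp _ with hf₀
  have hNf₀ : 0 < N f₀ := by
    rw [hNv v₀ hv₀]
    exact Real.rpow_pos_of_pos (by positivity) _
  have hf₀0 : f₀ ≠ 0 := fun h => by rw [h, map_zero] at hNf₀; exact hNf₀.ne rfl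
  -- Hahn–Banach starts from `c • f₀ ↦ c N(f₀)` on a line; domination by `N` survives the extension
  -- and becomes the lower bound for `α`.
  let φ : Module.Dual ℝ (ℝ ∙ f₀) := N f₀ • (LinearEquiv.coord ℝ _ f₀ hf₀0).toLinearMap
  have hφ : ∀ x : (ℝ ∙ f₀), φ x ≤ N x := by
    rintro ⟨x, hx⟩
    obtain ⟨c, rfl⟩ := Submodule.mem_span_singleton.1 hx
    have : LinearEquiv.coord ℝ _ f₀ hf₀0 ⟨c • f₀, hx⟩ = c := by
      rw [LinearEquiv.coord, LinearEquiv.symm_apply_eq]; rfl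
    simp only [φ, LinearMap.smul_apply, LinearEquiv.coe_coe, this, smul_eq_mul, map_smul_eq_mul,
      Real.norm_eq_abs]
    rw [mul_comm]
    exact mul_le_mul_of_nonneg_right (le_abs_self c) hNf₀.le
  obtain ⟨l, hl, hlN⟩ := Module.Dual.exists_continuous_extension_of_le_seminorm_real
    (ℝ ∙ f₀) φ (hα.continuous_seminormLp hp hlsc) hφ
  obtain ⟨w, hw, hrep⟩ := exists_memLp_forall_apply_eq_integral_inner hpq.symm l
  have hrep' : ∀ v (hv : MemLpLoc p v),
      l ((hmem v hv).toLp _) = ∫ x in D, ⟪v x, w x⟫ := fun v hv => by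
    rw [hrep, ← integral_indicator hD]
    refine integral_congr_ae ?_
    filter_upwards [(hmem v hv).coeFn_toLp] with x hx
    rw [hx]
    by_cases h : x ∈ D <;> simp [h]
  refine ⟨w, hw, fun v hv => ?_, ?_⟩
  · rw [← hrep' v hv, ← coreNorm_rpow hp, ← hNv v hv]
    exact Real.rpow_le_rpow (abs_nonneg _) (hlN _) (by linarith)
  · rw [← hrep' v₀ hv₀]
    have h1 := hl ⟨f₀, Submodule.mem_span_singleton_self f₀⟩
    have : φ ⟨f₀, Submodule.mem_span_singleton_self f₀⟩ = N f₀ := by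
      simp [φ, LinearEquiv.coord_self]
    change l f₀ ≠ 0
    rw [h1.trans this]
    exact hNf₀.ne'

end IsCoreFunctional

/-! ### Similarities and changes of variables. -/

/-- The rotation `x ↦ R x` of `ℝⁿ`. -/
def rotation (R : Matrix.specialOrthogonalGroup (Fin n) ℝ) : E n →L[ℝ] E n :=
  Matrix.toEuclideanCLM (𝕜 := ℝ) (R : Matrix (Fin n) (Fin n) ℝ)

theorem norm_rotation_apply (R : Matrix.specialOrthogonalGroup (Fin n) ℝ) (x : E n) :
    ‖rotation R x‖ = ‖x‖ := by
  have h := Unitary.map_mem (Matrix.toEuclideanCLM (n := Fin n) (𝕜 := ℝ)) R.2.1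
  exact ContinuousLinearMap.norm_map_of_mem_unitary h x

theorem norm_rotation_le (R : Matrix.specialOrthogonalGroup (Fin n) ℝ) : ‖rotation R‖ ≤ 1 :=
  ContinuousLinearMap.opNorm_le_bound _ zero_le_one fun x => by
    rw [norm_rotation_apply, one_mul]

/-- The rotation `x ↦ R x` as a linear isometry. -/
def rotationEquiv (R : Matrix.specialOrthogonalGroup (Fin n) ℝ) : E n ≃ₗᵢ[ℝ] E n :=
  LinearIsometry.toLinearIsometryEquiv
    ⟨(rotation R).toLinearMap, fun x => norm_rotation_apply R x⟩ rfl

/-- The map `x ↦ ε R x + h`. -/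
def similarity {ε : ℝ} (hε : ε ≠ 0) (R : Matrix.specialOrthogonalGroup (Fin n) ℝ) (h : E n) :
    E n ≃ᵃ[ℝ] E n :=
  ((rotationEquiv R).toLinearEquiv.trans (LinearEquiv.smulOfNeZero ℝ (E n) ε hε)).toAffineEquiv.trans
    (AffineEquiv.constVAdd ℝ (E n) h)

theorem similarity_apply {ε : ℝ} (hε : ε ≠ 0) (R : Matrix.specialOrthogonalGroup (Fin n) ℝ)
    (h x : E n) : similarity hε R h x = ε • rotation R x + h := add_comm _ _

variable {G : Subgroup (Matrix.specialOrthogonalGroup (Fin n) ℝ)}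

theorem similarity_mem {ε : ℝ} (hε : ε ≠ 0) {R : Matrix.specialOrthogonalGroup (Fin n) ℝ}
    (hR : R ∈ G) (h : E n) : similarity hε R h ∈ similarities G ε :=
  ⟨R, hR, h, similarity_apply hε R h⟩

theorem mem_similarityGroup_of_mem {ε : ℝ} (hε : 0 < ε) {F : E n ≃ᵃ[ℝ] E n}
    (hF : F ∈ similarities G ε) : F ∈ similarityGroup G := ⟨ε, hε, hF⟩

theorem eq_similarity {ε : ℝ} (hε : ε ≠ 0) {F : E n ≃ᵃ[ℝ] E n} (hF : F ∈ similarities G ε) :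
    ∃ R ∈ G, ∃ h, F = similarity hε R h := by
  obtain ⟨R, hR, h, e⟩ := hF
  exact ⟨R, hR, h, AffineEquiv.ext fun x => (e x).trans (similarity_apply hε R h x).symm⟩

theorem continuous_affineEquiv (F : E n ≃ᵃ[ℝ] E n) : Continuous F :=
  F.toAffineMap.continuous_of_finiteDimensional

theorem measurableEmbedding_affineEquiv (F : E n ≃ᵃ[ℝ] E n) : MeasurableEmbedding F :=
  (AffineEquiv.toContinuousAffineEquiv F).toHomeomorph.measurableEmbedding

theorem isOpen_image_affineEquiv (F : E n ≃ᵃ[ℝ] E n) {D : Set (E n)} (hD : IsOpen D) :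
    IsOpen (F '' D) :=
  (AffineEquiv.toContinuousAffineEquiv F).toHomeomorph.isOpenMap _ hD

theorem measurePreserving_similarity {ε : ℝ} (hε : 0 < ε)
    (R : Matrix.specialOrthogonalGroup (Fin n) ℝ) (h : E n) :
    MeasurePreserving (similarity hε.ne' R h) volume (ENNReal.ofReal (ε ^ n)⁻¹ • volume) := by
  have h1 : MeasurePreserving (rotationEquiv R) volume volume := (rotationEquiv R).measurePreserving
  have h2 : MeasurePreserving (fun x : E n => ε • x) volume (ENNReal.ofReal (ε ^ n)⁻¹ • volume) := by
    refine ⟨measurable_const_smul ε, ?_⟩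
    rw [Measure.map_addHaar_smul volume hε.ne', abs_of_pos (by positivity)]
    simp
  have h3 : MeasurePreserving (fun x : E n => x + h) (ENNReal.ofReal (ε ^ n)⁻¹ • volume)
      (ENNReal.ofReal (ε ^ n)⁻¹ • volume) :=
    (measurePreserving_add_right volume h).smul_measure _
  have := h3.comp (h2.comp h1)
  convert this using 1
  ext1 x
  exact similarity_apply hε.ne' R h x

theorem hasFDerivAt_similarity {ε : ℝ} (hε : ε ≠ 0)
    (R : Matrix.specialOrthogonalGroup (Fin n) ℝ) (h x : E n) :
    HasFDerivAt (similarity hε R h) (ε • rotation R) x := by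
  have : (similarity hε R h : E n → E n) = fun x => (ε • rotation R) x + h :=
    funext fun x => similarity_apply hε R h x
  rw [this]
  exact (ContinuousLinearMap.hasFDerivAt _).add_const h

theorem setIntegral_comp_similarity {W : Type*} [NormedAddCommGroup W] [NormedSpace ℝ W] {ε : ℝ}
    (hε : 0 < ε) (R : Matrix.specialOrthogonalGroup (Fin n) ℝ) (h : E n) (D : Set (E n))
    (f : E n → W) :
    ∫ x in D, f (similarity hε.ne' R h x) =
      (ε ^ n)⁻¹ • ∫ x in similarity hε.ne' R h '' D, f x := by
  rw [(measurePreserving_similarity hε R h).setIntegral_image_emb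
    (measurableEmbedding_affineEquiv _) f D |>.symm, Measure.restrict_smul, integral_smul_measure,
    ENNReal.toReal_ofReal (by positivity)]

theorem memLp_comp_similarity {W : Type*} [NormedAddCommGroup W] {ε : ℝ} {q : ℝ≥0∞}
    (hε : 0 < ε) (R : Matrix.specialOrthogonalGroup (Fin n) ℝ) (h : E n) {D : Set (E n)}
    {f : E n → W} (hf : MemLp f q (volume.restrict (similarity hε.ne' R h '' D))) :
    MemLp (f ∘ similarity hε.ne' R h) q (volume.restrict D) := by
  have h1 := (measurePreserving_similarity hε R h).restrict_image_emb
    (measurableEmbedding_affineEquiv _) D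
  rw [Measure.restrict_smul] at h1
  exact (hf.smul_measure ENNReal.ofReal_ne_top).comp_measurePreserving h1

theorem MemLpLoc.comp_similarity {u : E n → E m} (hu : MemLpLoc p u) {ε : ℝ}
    (hε : 0 < ε) (R : Matrix.specialOrthogonalGroup (Fin n) ℝ) (h : E n) :
    MemLpLoc p (u ∘ similarity hε.ne' R h) := fun _ hK =>
  memLp_comp_similarity hε R h (hu _ (hK.image (continuous_affineEquiv _)))

theorem MemLpLoc.locallyIntegrable {u : E n → E m} (hu : MemLpLoc p u) (hp : 1 ≤ p) :
    LocallyIntegrable u volume := by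
  rw [locallyIntegrable_iff]
  intro K hK
  have : IsFiniteMeasure (volume.restrict K) := isFiniteMeasure_restrict.2 hK.measure_lt_top.ne
  exact (hu K hK).integrable (ENNReal.one_le_ofReal.2 hp)

theorem LocallyIntegrable.tensorGrad {u : E n → E m} (hu : LocallyIntegrable u volume)
    {φ : E n → ℝ} (hφ : ContDiff ℝ ((⊤ : ℕ∞) : WithTop ℕ∞) φ) (hc : HasCompactSupport φ) :
    Integrable (tensorGrad u φ) volume := by
  have hcont : Continuous (fderiv ℝ φ) := hφ.continuous_fderiv (by simp)
  have h1 := hu.integrable_smul_left_of_hasCompactSupport hcont.norm (hc.fderiv ℝ).norm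
  refine h1.mono ?_ (ae_of_all _ fun x => ?_)
  · exact (ContinuousLinearMap.smulRightL ℝ (E n) (E m)).aestronglyMeasurable_comp₂
      hcont.aestronglyMeasurable hu.aestronglyMeasurable
  · rw [BMOType.tensorGrad, ContinuousLinearMap.norm_smulRight_apply, norm_smul, norm_norm]

theorem tensorGrad_eq_zero {u : E n → E m} {φ : E n → ℝ} {x : E n} (hx : x ∉ tsupport φ) :
    tensorGrad u φ x = 0 := by
  have : fderiv ℝ φ x = 0 := by
    by_contra h
    exact hx (support_fderiv_subset ℝ h)
  rw [tensorGrad, this]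
  ext; simp

/-- The weak gradient of `u ∘ F` for a similarity `F`. -/
theorem HasWeakD.comp_similarity {Ω D : Set (E n)} {u : E n → E m} {g : E n → Mat m n}
    (hg : HasWeakD LinearMap.id Ω u g) (hΩ : MeasurableSet Ω) {ε : ℝ}
    (hε : 0 < ε) (R : Matrix.specialOrthogonalGroup (Fin n) ℝ) (h : E n)
    (hsub : similarity hε.ne' R h '' D ⊆ Ω) (hgL : LocallyIntegrable g (volume.restrict Ω))
    (hu : LocallyIntegrable u volume) :
    HasWeakD LinearMap.id D (u ∘ similarity hε.ne' R h)
      (fun x => (g (similarity hε.ne' R h x)).comp (ε • rotation R)) := by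
  intro φ hφ hc hsupp
  set F := similarity hε.ne' R h with hF
  set L := ε • rotation R
  let Fh : E n ≃ₜ E n := (AffineEquiv.toContinuousAffineEquiv F).toHomeomorph
  have hsm : ContDiff ℝ ((⊤ : ℕ∞) : WithTop ℕ∞) F.symm :=
    (AffineEquiv.toContinuousAffineEquiv F.symm).toContinuousAffineMap.contDiff
  -- The test function is transported to the image side, where the weak gradient of `u` is known;
  -- the chain rule for `φ = ψ ∘ F` brings in the factor `L`.
  set ψ := φ ∘ F.symm with hψ
  have hψF : ∀ x, ψ (F x) = φ x := fun x => by simp [hψ]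
  have hψs : ContDiff ℝ ((⊤ : ℕ∞) : WithTop ℕ∞) ψ := hφ.comp hsm
  have hψc : HasCompactSupport ψ := hc.comp_homeomorph Fh.symm
  have hψt : tsupport ψ ⊆ F '' D := by
    have : tsupport ψ = Fh.symm ⁻¹' tsupport φ := tsupport_comp_eq_preimage φ Fh.symm
    rw [this]
    intro y hy
    exact ⟨F.symm y, hsupp hy, by simp⟩
  have h0 := hg ψ hψs hψc (hψt.trans hsub)
  have hz1 : ∫ x in Ω, ψ x • g x = ∫ x in F '' D, ψ x • g x :=
    setIntegral_eq_of_subset_of_forall_sdiff_eq_zero hΩ hsub fun x hx => by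
      rw [image_eq_zero_of_notMem_tsupport fun hh => hx.2 (hψt hh)]
      exact zero_smul ℝ (g x)
  have hz2 : ∫ x in Ω, tensorGrad u ψ x = ∫ x in F '' D, tensorGrad u ψ x :=
    setIntegral_eq_of_subset_of_forall_sdiff_eq_zero hΩ hsub fun x hx =>
      tensorGrad_eq_zero fun hh => hx.2 (hψt hh)
  simp only [LinearMap.id_apply] at h0 ⊢
  rw [hz1, hz2] at h0
  have h1 : ∫ x in D, φ x • g (F x) = -∫ x in D, tensorGrad u ψ (F x) := by
    have e1 := setIntegral_comp_similarity hε R h D fun y => ψ y • g y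
    have e2 := setIntegral_comp_similarity hε R h D (tensorGrad u ψ)
    rw [← hF] at e1 e2
    simp only [hψF] at e1
    rw [e1, e2, h0, smul_neg]
  have hi1 : Integrable (fun x => φ x • g (F x)) (volume.restrict D) := by
    have i0 : Integrable (fun y => ψ y • g y) (volume.restrict (F '' D)) :=
      (hgL.integrable_smul_left_of_hasCompactSupport hψs.continuous hψc).mono_measure
        (Measure.restrict_mono hsub le_rfl)
    have := memLp_comp_similarity hε R h (memLp_one_iff_integrable.2 i0)
    rw [memLp_one_iff_integrable] at this
    refine this.congr (ae_of_all _ fun x => ?_)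
    simp [← hF, hψF]
  have hi2 : Integrable (fun x => tensorGrad u ψ (F x)) (volume.restrict D) := by
    have i0 : Integrable (tensorGrad u ψ) (volume.restrict (F '' D)) :=
      (LocallyIntegrable.tensorGrad hu hψs hψc).restrict
    exact memLp_one_iff_integrable.1
      (memLp_comp_similarity hε R h (memLp_one_iff_integrable.2 i0))
  let P : Mat m n →L[ℝ] Mat m n := (ContinuousLinearMap.compL ℝ (E n) (E n) (E m)).flip L
  have hP : ∀ A : Mat m n, P A = A.comp L := fun A => rfl
  have hgrad : ∀ x, tensorGrad (u ∘ F) φ x = P (tensorGrad u ψ (F x)) := fun x => by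
    have hd : fderiv ℝ φ x = (fderiv ℝ ψ (F x)).comp L := by
      have : φ = ψ ∘ F := funext fun x => (hψF x).symm
      conv_lhs => rw [this]
      exact ((hψs.differentiable (by simp) (F x)).hasFDerivAt.comp x
        (hasFDerivAt_similarity hε.ne' R h x)).fderiv
    rw [hP, tensorGrad, hd]
    ext y
    simp [tensorGrad]
  calc ∫ x in D, φ x • (g (F x)).comp L = ∫ x in D, P (φ x • g (F x)) := by
        refine integral_congr_ae (ae_of_all _ fun x => ?_)
        simp only [hP, ContinuousLinearMap.smul_comp]
    _ = P (∫ x in D, φ x • g (F x)) := P.integral_comp_comm hi1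
    _ = -∫ x in D, tensorGrad (u ∘ F) φ x := by
        rw [h1, map_neg, ← P.integral_comp_comm hi2]
        simp_rw [hgrad]

/-! ### The upper bound by the gradient. -/

variable {D : Set (E n)} {α : (E n → E m) → Set (E n) → ℝ≥0}

theorem IsCoreFunctional.apply_empty (hα : IsCoreFunctional p ∅ (similarityGroup G) α)
    (hp : 1 < p) {u : E n → E m} (hu : MemLpLoc p u) : α u ∅ = 0 := by
  rw [hα.ext_indep ∅ (self_mem_images ∅ _) u 0 hu (memLpLoc_of_continuous continuous_const)
    (by rw [Measure.restrict_empty, ae_zero]; exact eventually_bot)]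
  exact hα.apply_zero hp

/-- Lets the supremum over sets of images be tested with indexed families. Disjoint nonempty images
are distinct, so the indexing is injective; when `D` is empty every term vanishes. -/
theorem ofReal_mul_tsum_le_bmo (hα : IsCoreFunctional p D (similarityGroup G) α) (hp : 1 < p)
    {u : E n → E m} (hu : MemLpLoc p u) {ε : ℝ} {Ω : Set (E n)} {ι : Type*}
    (F : ι → E n ≃ᵃ[ℝ] E n) (hF : ∀ i, F i ∈ similarities G ε) (hsub : ∀ i, F i '' D ⊆ Ω)
    (hd : Pairwise (Function.onFun Disjoint fun i => F i '' D)) :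
    ENNReal.ofReal (ε ^ ((n : ℝ) - p)) * ∑' i, (α u (F i '' D) : ℝ≥0∞) ≤ bmo p D G α ε u Ω := by
  refine mul_le_mul_right ?_ _
  rcases D.eq_empty_or_nonempty with rfl | hne
  · simp [hα.apply_empty hp hu]
  have hinj : Function.Injective fun i => F i '' D := fun i j hij => by
    by_contra hne'
    have h1 : Disjoint (F i '' D) (F j '' D) := hd hne'
    rw [show F j '' D = F i '' D from hij.symm, disjoint_self] at h1
    exact (hne.image (F i)).ne_empty h1
  let 𝓕 : Set (Set (E n)) := Set.range fun i => F i '' D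
  have h𝓕 : 𝓕 ⊆ images D (similarities G ε) Ω ∧ 𝓕.PairwiseDisjoint id := by
    constructor
    · rintro _ ⟨i, rfl⟩
      exact ⟨⟨F i, hF i, rfl⟩, hsub i⟩
    · rintro _ ⟨i, rfl⟩ _ ⟨j, rfl⟩ hij
      exact hd fun h => hij (by rw [h])
  refine le_trans (le_of_eq ?_) (le_iSup _ (⟨𝓕, h𝓕⟩ :
    {𝓕 : Set (Set (E n)) // 𝓕 ⊆ images D (similarities G ε) Ω ∧ 𝓕.PairwiseDisjoint id}))
  exact ((Equiv.ofInjective _ hinj).tsum_eq fun D' : 𝓕 => (α u D' : ℝ≥0∞))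

/-- The gradient of `u ∘ F` is `ε (g ∘ F) R`, which produces `ε^p`, and the change of variables
produces `ε^{-n}`. Together they cancel the prefactor `ε^{n-p}` of `bmo`. -/
theorem IsCoreFunctional.apply_image_le (hα : IsCoreFunctional p D (similarityGroup G) α)
    (hp : 1 < p) (hDb : Bornology.IsBounded D) {c₁ : ℝ} (hc : 0 < c₁)
    (hc₁ : ∀ u : E n → E m, MemLpLoc p u → ∀ g : E n → Mat m n,
      MemLp u (ENNReal.ofReal p) (volume.restrict D) →
      MemLp g (ENNReal.ofReal p) (volume.restrict D) →
      HasWeakD LinearMap.id D u g → (α u D : ℝ) ≤ c₁ * ∫ x in D, ‖g x‖ ^ p)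
    {u : E n → E m} (hu : MemLpLoc p u) {Ω : Set (E n)} (hΩ : MeasurableSet Ω)
    {g : E n → Mat m n} (hg : MemLp g (ENNReal.ofReal p) (volume.restrict Ω))
    (hw : HasWeakD LinearMap.id Ω u g) {ε : ℝ} (hε : 0 < ε)
    {R : Matrix.specialOrthogonalGroup (Fin n) ℝ} (hR : R ∈ G) (h : E n)
    (hsub : similarity hε.ne' R h '' D ⊆ Ω) :
    (α u (similarity hε.ne' R h '' D) : ℝ) ≤
      c₁ * (ε ^ p * (ε ^ n)⁻¹) * ∫ x in similarity hε.ne' R h '' D, ‖g x‖ ^ p := by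
  have hp0 : 0 < p := by linarith
  have hgD : MemLp g (ENNReal.ofReal p) (volume.restrict (similarity hε.ne' R h '' D)) :=
    hg.mono_measure (Measure.restrict_mono hsub le_rfl)
  have hgF := memLp_comp_similarity hε R h hgD
  let P : Mat m n →L[ℝ] Mat m n :=
    (ContinuousLinearMap.compL ℝ (E n) (E n) (E m)).flip (ε • rotation R)
  have hPF : MemLp (fun x => (g (similarity hε.ne' R h x)).comp (ε • rotation R))
      (ENNReal.ofReal p) (volume.restrict D) := P.comp_memLp' hgF
  have h1 := hc₁ _ (hu.comp_similarity hε R h) _ ((hu.comp_similarity hε R h).memLp_restrict hDb)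
    hPF (hw.comp_similarity hΩ hε R h hsub
      (hg.locallyIntegrable (ENNReal.one_le_ofReal.2 hp.le)) (hu.locallyIntegrable hp.le))
  rw [hα.apply_image hu (mem_similarityGroup_of_mem hε (similarity_mem hε.ne' hR h))]
  refine h1.trans ?_
  rw [mul_assoc]
  refine mul_le_mul_of_nonneg_left ?_ hc.le
  have hbd : ∀ x, ‖(g (similarity hε.ne' R h x)).comp (ε • rotation R)‖ ^ p ≤
      ε ^ p * ‖g (similarity hε.ne' R h x)‖ ^ p := fun x => by
    rw [← Real.mul_rpow hε.le (norm_nonneg _)]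
    refine Real.rpow_le_rpow (norm_nonneg _) ?_ hp0.le
    refine (ContinuousLinearMap.opNorm_comp_le _ _).trans ?_
    rw [norm_smul, Real.norm_of_nonneg hε.le, mul_comm]
    refine mul_le_mul_of_nonneg_right ?_ (norm_nonneg _)
    exact mul_le_of_le_one_right hε.le (norm_rotation_le R)
  have hint : Integrable (fun x => ‖g (similarity hε.ne' R h x)‖ ^ p) (volume.restrict D) := by
    have := hgF.integrable_norm_rpow (by simpa using hp0) ENNReal.ofReal_ne_top
    rwa [ENNReal.toReal_ofReal hp0.le] at this
  have hint' : Integrable (fun x => ‖(g (similarity hε.ne' R h x)).comp (ε • rotation R)‖ ^ p)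
      (volume.restrict D) := by
    have := hPF.integrable_norm_rpow (by simpa using hp0) ENNReal.ofReal_ne_top
    rwa [ENNReal.toReal_ofReal hp0.le] at this
  calc ∫ x in D, ‖(g (similarity hε.ne' R h x)).comp (ε • rotation R)‖ ^ p
      ≤ ∫ x in D, ε ^ p * ‖g (similarity hε.ne' R h x)‖ ^ p :=
        integral_mono hint' (hint.const_mul _) hbd
    _ = ε ^ p * (ε ^ n)⁻¹ * ∫ x in similarity hε.ne' R h '' D, ‖g x‖ ^ p := by
        rw [integral_const_mul, setIntegral_comp_similarity hε R h D fun y => ‖g y‖ ^ p,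
          smul_eq_mul, mul_assoc]

theorem rpow_sub_mul_rpow_mul_inv_pow {ε : ℝ} (hε : 0 < ε) (n : ℕ) (p : ℝ) :
    ε ^ ((n : ℝ) - p) * (ε ^ p * (ε ^ n)⁻¹) = 1 := by
  rw [← mul_assoc, ← Real.rpow_add hε, sub_add_cancel, Real.rpow_natCast,
    mul_inv_cancel₀ (by positivity)]

/-- The upper bound of the seminorm by the `L^p` norm of the gradient. -/
theorem exists_bmo_le (hα : IsCoreFunctional p D (similarityGroup G) α)
    (hp : 1 < p) (hD : IsOpen D) (hDb : Bornology.IsBounded D) :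
    ∃ c₁ : ℝ, ∀ (u : E n → E m), MemLpLoc p u → ∀ Ω : Set (E n), MeasurableSet Ω →
      ∀ g : E n → Mat m n, MemLp g (ENNReal.ofReal p) (volume.restrict Ω) →
      HasWeakD LinearMap.id Ω u g → ∀ ε : ℝ, 0 < ε →
      bmo p D G α ε u Ω ≤ ENNReal.ofReal (c₁ * ∫ x in Ω, ‖g x‖ ^ p) := by
  have hp0 : 0 < p := by linarith
  obtain ⟨c₁, hc, hc₁⟩ := hα.grad_bound
  refine ⟨c₁, fun u hu Ω hΩ g hg hw ε hε => ?_⟩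
  have hgi : Integrable (fun x => ‖g x‖ ^ p) (volume.restrict Ω) := by
    have := hg.integrable_norm_rpow (by simpa using hp0) ENNReal.ofReal_ne_top
    rwa [ENNReal.toReal_ofReal hp0.le] at this
  have key : ∀ 𝓕 : Set (Set (E n)), 𝓕 ⊆ images D (similarities G ε) Ω → 𝓕.PairwiseDisjoint id →
      ∑' D' : 𝓕, (α u D' : ℝ≥0∞) ≤
        ENNReal.ofReal (c₁ * (ε ^ p * (ε ^ n)⁻¹) * ∫ x in Ω, ‖g x‖ ^ p) := by
    intro 𝓕 h𝓕 hd
    -- Finite subfamilies suffice, so the integrals over disjoint images simply add up inside `Ω`.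
    rw [ENNReal.tsum_eq_iSup_sum]
    refine iSup_le fun t => ?_
    have hopen : ∀ D' : 𝓕, IsOpen (D' : Set (E n)) := fun D' => by
      obtain ⟨⟨F, -, hF⟩, -⟩ := h𝓕 D'.2
      rw [hF]; exact isOpen_image_affineEquiv F hD
    have hle : ∀ D' : 𝓕, (α u D' : ℝ) ≤
        c₁ * (ε ^ p * (ε ^ n)⁻¹) * ∫ x in (D' : Set (E n)), ‖g x‖ ^ p := fun D' => by
      obtain ⟨⟨F, hFG, hF⟩, hsub⟩ := h𝓕 D'.2
      obtain ⟨R, hR, h, rfl⟩ := eq_similarity hε.ne' hFG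
      rw [hF] at hsub ⊢
      exact hα.apply_image_le hp hDb hc hc₁ hu hΩ hg hw hε hR h hsub
    have hsum : ∑ D' ∈ t, ∫ x in (D' : Set (E n)), ‖g x‖ ^ p ≤ ∫ x in Ω, ‖g x‖ ^ p := by
      rw [← integral_biUnion_finset t (fun D' _ => (hopen D').measurableSet)
        (fun D' _ D'' _ hne => hd D'.2 D''.2 fun h => hne (Subtype.ext h))
        (fun D' _ => IntegrableOn.mono_set hgi (h𝓕 D'.2).2)]
      refine setIntegral_mono_set hgi (ae_of_all _ fun x => by positivity) ?_
      exact (Set.iUnion₂_subset fun D' _ => (h𝓕 D'.2).2).eventuallyLE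
    calc ∑ D' ∈ t, (α u D' : ℝ≥0∞) = ENNReal.ofReal (∑ D' ∈ t, (α u D' : ℝ)) := by
          rw [ENNReal.ofReal_sum_of_nonneg fun _ _ => by positivity]
          simp
      _ ≤ _ := by
          refine ENNReal.ofReal_le_ofReal ((Finset.sum_le_sum fun D' _ => hle D').trans ?_)
          rw [← Finset.mul_sum]
          exact mul_le_mul_of_nonneg_left hsum (by positivity)
  rw [bmo]
  refine (mul_le_mul_right (iSup_le fun 𝓕 : {𝓕 : Set (Set (E n)) //
    𝓕 ⊆ images D (similarities G ε) Ω ∧ 𝓕.PairwiseDisjoint id} => key 𝓕.1 𝓕.2.1 𝓕.2.2) _).trans_eq ?_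
  rw [← ENNReal.ofReal_mul (by positivity)]
  congr 1
  linear_combination (c₁ * ∫ x in Ω, ‖g x‖ ^ p) * rpow_sub_mul_rpow_mul_inv_pow hε n p

/-! ### The function `ψ` on linear maps. -/

theorem hasWeakD_continuousLinearMap (A : Mat m n) (Ω : Set (E n)) :
    HasWeakD LinearMap.id Ω (A : E n → E m) fun _ => A := by
  intro φ hφ hc hsupp
  have hd : Differentiable ℝ φ := hφ.differentiable (by simp)
  have hcont : Continuous (fderiv ℝ φ) := hφ.continuous_fderiv (by simp)
  have hA : LocallyIntegrable (A : E n → E m) volume := A.continuous.locallyIntegrable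
  have hiT := LocallyIntegrable.tensorGrad hA hφ hc
  have hiA : Integrable (fun x => φ x • A) volume :=
    (hφ.continuous.integrable_of_hasCompactSupport hc).smul_const A
  have e1 : ∫ x in Ω, φ x • A = ∫ x, φ x • A :=
    setIntegral_eq_integral_of_forall_compl_eq_zero fun x hx => by
      rw [image_eq_zero_of_notMem_tsupport fun hh => hx (hsupp hh)]
      exact zero_smul ℝ A
  have e2 : ∫ x in Ω, tensorGrad A φ x = ∫ x, tensorGrad A φ x :=
    setIntegral_eq_integral_of_forall_compl_eq_zero fun x hx =>
      tensorGrad_eq_zero fun hh => hx (hsupp hh)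
  simp only [LinearMap.id_apply]
  rw [e1, e2]
  ext1 v
  have happ := fun (f : E n → Mat m n) (hf : Integrable f volume) =>
    (ContinuousLinearMap.integral_apply hf v)
  rw [neg_apply, happ _ hiA, happ _ hiT]
  have := integral_bilinear_fderiv_right_eq_neg_left_of_integrable (μ := volume) (f := φ)
    (g := (A : E n → E m)) (v := v) (B := ContinuousLinearMap.lsmul ℝ ℝ)
    (by simpa [tensorGrad] using hiT.apply_continuousLinearMap v)
    (by simpa using hiA.apply_continuousLinearMap v)
    (by simpa using hA.integrable_smul_left_of_hasCompactSupport hφ.continuous hc)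
    (fun x _ => hd x) (fun x _ => A.differentiableAt)
  simpa [tensorGrad] using this

/-- Here `A ∘ F = ε AR + Ah`: the constant drops out and homogeneity extracts `ε^p`. -/
theorem IsCoreFunctional.apply_continuousLinearMap_image
    (hα : IsCoreFunctional p D (similarityGroup G) α) (A : Mat m n) {ε : ℝ} (hε : 0 < ε)
    {R : Matrix.specialOrthogonalGroup (Fin n) ℝ} (hR : R ∈ G) (h : E n) :
    (α A (similarity hε.ne' R h '' D) : ℝ) = ε ^ p * α (A.comp (rotation R)) D := by
  have hA : MemLpLoc p (A : E n → E m) := memLpLoc_of_continuous A.continuous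
  have hAR : MemLpLoc p (A.comp (rotation R) : E n → E m) :=
    memLpLoc_of_continuous (A.comp (rotation R)).continuous
  rw [hα.apply_image hA (mem_similarityGroup_of_mem hε (similarity_mem hε.ne' hR h))]
  have e : (A : E n → E m) ∘ similarity hε.ne' R h =
      fun x => (ε • (A.comp (rotation R) : E n → E m)) x + A h := by
    ext1 x
    simp [similarity_apply]
  rw [e, hα.trans_inv D (self_mem_images D _) _ (hAR.const_smul ε),
    hα.homogeneous D (self_mem_images D _) _ hAR, abs_of_pos hε]

theorem measure_unitCube_lt_top (n : ℕ) : volume (unitCube n) < ⊤ := by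
  refine Bornology.IsBounded.measure_lt_top ?_
  refine Metric.isBounded_closedBall.subset (s := unitCube n) (t := Metric.closedBall 0 √n)
    fun x hx => ?_
  rw [mem_closedBall_zero_iff, EuclideanSpace.norm_eq]
  refine Real.sqrt_le_sqrt ?_
  calc ∑ i, ‖x i‖ ^ 2 ≤ ∑ _i : Fin n, (1 : ℝ) := Finset.sum_le_sum fun i _ => by
        rw [Real.norm_eq_abs, sq_abs]
        nlinarith [hx i]
    _ = n := by simp

theorem measurableSet_unitCube (n : ℕ) : MeasurableSet (unitCube n) := by
  have : unitCube n = ⋂ i, {x : E n | -(1 / 2 : ℝ) < x i ∧ x i < 1 / 2} := by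
    ext x; simp [unitCube]
  rw [this]
  refine MeasurableSet.iInter fun i => ?_
  have hc : Continuous fun x : E n => x i := by fun_prop
  exact ((isOpen_lt continuous_const hc).inter (isOpen_lt hc continuous_const)).measurableSet

/-- Packing `k ^ n` translated copies of a rescaled family into the unit cube. -/
theorem ofReal_mul_le_bmo_unitCube (hα : IsCoreFunctional p D (similarityGroup G) α) (hp : 1 < p)
    (A : Mat m n) {ε ε₀ : ℝ} (hε : 0 < ε) (hε₀ : 0 < ε₀) (k : ℕ) (hk : k * (ε / ε₀) ≤ 1) :
    ENNReal.ofReal ((k * (ε / ε₀)) ^ n) * bmo p D G α ε₀ A (unitCube n) ≤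
      bmo p D G α ε A (unitCube n) := by
  set s := ε / ε₀ with hs
  have hs0 : 0 < s := div_pos hε hε₀
  have hsε : s * ε₀ = ε := div_mul_cancel₀ _ hε₀.ne'
  rw [bmo, ENNReal.mul_iSup, ENNReal.mul_iSup]
  refine iSup_le fun 𝓕 => ?_
  obtain ⟨𝓕, h𝓕, hd⟩ := 𝓕
  choose F hFG hF using fun D' : 𝓕 => (h𝓕 D'.2).1
  choose R hR h hFR using fun D' : 𝓕 => eq_similarity hε₀.ne' (hFG D')
  have himg : ∀ D' : 𝓕, (D' : Set (E n)) = similarity hε₀.ne' (R D') (h D') '' D := fun D' => by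
    rw [← hFR, hF D']
  -- Unit cubes centred at these points fit disjointly into `(-k/2, k/2)^n`; scaling by `s` puts
  -- them inside the unit cube because `k s ≤ 1`.
  let c : (Fin n → Fin k) → E n := fun j => WithLp.toLp 2 fun i => (j i : ℝ) - ((k : ℝ) - 1) / 2
  let H : (Fin n → Fin k) → E n → E n := fun j x => s • (x + c j)
  have hHi : ∀ j x i, H j x i = s * (x i + ((j i : ℝ) - ((k : ℝ) - 1) / 2)) := fun j x i => by
    simp [H, c, mul_add]
  let F' : (Fin n → Fin k) × 𝓕 → E n ≃ᵃ[ℝ] E n := fun z =>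
    similarity hε.ne' (R z.2) (s • (h z.2 + c z.1))
  have hF' : ∀ z, F' z '' D = H z.1 '' (z.2 : Set (E n)) := fun z => by
    rw [himg z.2, Set.image_image]
    refine Set.image_congr fun x _ => ?_
    simp only [F', H, similarity_apply, smul_add, smul_smul, hsε]
    abel
  have hsubQ : ∀ z, F' z '' D ⊆ unitCube n := fun z => by
    rw [hF']
    rintro _ ⟨x, hx, rfl⟩ i
    have hxi := (h𝓕 z.2.2).2 hx i
    rw [hHi]
    have h1 : (0 : ℝ) ≤ (z.1 i : ℝ) := by positivity
    have h2 : ((z.1 i : ℕ) : ℝ) + 1 ≤ k := by exact_mod_cast (z.1 i).2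
    constructor
    · nlinarith
    · nlinarith
  have hdisj : Pairwise (Function.onFun Disjoint fun z => F' z '' D) := by
    intro z z' hzz
    simp only [Function.onFun, hF']
    rw [Set.disjoint_left]
    rintro y ⟨x, hx, rfl⟩ ⟨x', hx', hxx⟩
    -- A common point forces each pair of integer coordinates to differ by less than `1`.
    have hj : z.1 = z'.1 := by
      ext i
      have hxi := (h𝓕 z.2.2).2 hx i
      have hxi' := (h𝓕 z'.2.2).2 hx' i
      have e : H z'.1 x' i = H z.1 x i := by rw [hxx]
      rw [hHi, hHi] at e
      have e' := mul_left_cancel₀ hs0.ne' e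
      have a1 : ((z.1 i : ℕ) : ℝ) < (z'.1 i : ℕ) + 1 := by linarith
      have a2 : ((z'.1 i : ℕ) : ℝ) < (z.1 i : ℕ) + 1 := by linarith
      have b1 : (z.1 i : ℕ) < (z'.1 i : ℕ) + 1 := by exact_mod_cast a1
      have b2 : (z'.1 i : ℕ) < (z.1 i : ℕ) + 1 := by exact_mod_cast a2
      omega
    have hx2 : x' = x := by
      have : s • (x' + c z'.1) = s • (x + c z.1) := hxx
      rw [hj] at this
      exact add_right_cancel (smul_right_injective _ hs0.ne' this)
    have hne : z.2 ≠ z'.2 := fun hh => hzz (Prod.ext hj hh)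
    have := hd z.2.2 z'.2.2 fun hh => hne (Subtype.ext hh)
    exact Set.disjoint_left.1 this hx (hx2 ▸ hx')
  have hval : ∀ z, (α A (F' z '' D) : ℝ≥0∞) = ENNReal.ofReal (s ^ p) * α A z.2 := fun z => by
    have e1 := hα.apply_continuousLinearMap_image A hε (hR z.2) (s • (h z.2 + c z.1))
    have e2 := hα.apply_continuousLinearMap_image A hε₀ (hR z.2) (h z.2)
    rw [← himg] at e2
    have e3 : (α A (F' z '' D) : ℝ) = s ^ p * α A z.2 := by
      rw [e2, ← mul_assoc, ← Real.mul_rpow hs0.le hε₀.le, hsε]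
      exact e1
    rw [← ENNReal.ofReal_coe_nnreal, e3, ENNReal.ofReal_mul (by positivity),
      ENNReal.ofReal_coe_nnreal]
  have key := ofReal_mul_tsum_le_bmo hα hp (memLpLoc_of_continuous A.continuous) F'
    (fun z => similarity_mem hε.ne' (hR z.2) _) hsubQ hdisj
  refine le_trans (le_of_eq ?_) key
  simp_rw [hval]
  rw [ENNReal.tsum_mul_left, ENNReal.tsum_prod (f := fun _ (D' : 𝓕) => (α A D' : ℝ≥0∞)), tsum_fintype (L := .unconditional (Fin n → Fin k)),
    Finset.sum_const, Finset.card_univ,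
    Fintype.card_fun, Fintype.card_fin, Fintype.card_fin, nsmul_eq_mul]
  set S := ∑' D' : 𝓕, (α A D' : ℝ≥0∞)
  have hkn : ((k ^ n : ℕ) : ℝ≥0∞) = ENNReal.ofReal ((k : ℝ) ^ n) := by
    rw [← ENNReal.ofReal_natCast]; push_cast; rfl
  rw [hkn, ← mul_assoc, ← mul_assoc, ← mul_assoc, ← ENNReal.ofReal_mul (by positivity),
    ← ENNReal.ofReal_mul (by positivity), ← ENNReal.ofReal_mul (by positivity)]
  congr 2
  have e4 : ε ^ ((n : ℝ) - p) = s ^ n / s ^ p * ε₀ ^ ((n : ℝ) - p) := by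
    rw [← hsε, Real.mul_rpow hs0.le hε₀.le, Real.rpow_sub hs0, Real.rpow_natCast]
  rw [e4, mul_pow]
  have : s ^ p ≠ 0 := (Real.rpow_pos_of_pos hs0 p).ne'
  field_simp

/-- Packing with `k = ⌊ε₀/ε⌋` loses only the factor `(1 - ε/ε₀)^n → 1`, so the liminf dominates the
value at every scale `ε₀`; the limsup is trivially at most the supremum. -/
theorem tendsto_bmo_unitCube (hα : IsCoreFunctional p D (similarityGroup G) α) (hp : 1 < p)
    (A : Mat m n) :
    Tendsto (fun ε : ℝ => bmo p D G α ε A (unitCube n)) (𝓝[>] 0)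
      (𝓝 (⨆ ε : Set.Ioi (0 : ℝ), bmo p D G α ε A (unitCube n))) := by
  refine tendsto_of_le_liminf_of_limsup_le ?_ ?_
  · refine iSup_le fun ε₀ => ?_
    obtain ⟨ε₀, hε₀⟩ := ε₀
    have hε₀ : 0 < ε₀ := hε₀
    have hev : ∀ᶠ ε in 𝓝[>] (0 : ℝ), ENNReal.ofReal ((1 - ε / ε₀) ^ n) *
        bmo p D G α ε₀ A (unitCube n) ≤ bmo p D G α ε A (unitCube n) := by
      have h1 : ∀ᶠ ε in 𝓝[>] (0 : ℝ), ε < ε₀ :=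
        (eventually_lt_nhds hε₀).filter_mono nhdsWithin_le_nhds
      filter_upwards [self_mem_nhdsWithin, h1] with ε hε hlt
      have hε : 0 < ε := hε
      have hs0 : 0 < ε / ε₀ := div_pos hε hε₀
      have hs1 : ε / ε₀ < 1 := (div_lt_one hε₀).2 hlt
      have hk1 : (⌊(ε / ε₀)⁻¹⌋₊ : ℝ) * (ε / ε₀) ≤ 1 := by
        rw [← le_div_iff₀ hs0, one_div]
        exact Nat.floor_le (by positivity)
      have hk2 : 1 - ε / ε₀ ≤ (⌊(ε / ε₀)⁻¹⌋₊ : ℝ) * (ε / ε₀) := by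
        have := Nat.lt_floor_add_one (ε / ε₀)⁻¹
        rw [inv_lt_iff_one_lt_mul₀ hs0] at this
        nlinarith
      refine le_trans ?_ (ofReal_mul_le_bmo_unitCube hα hp A hε hε₀ _ hk1)
      gcongr
    have hlim : Tendsto (fun ε : ℝ => ENNReal.ofReal ((1 - ε / ε₀) ^ n) *
        bmo p D G α ε₀ A (unitCube n)) (𝓝[>] 0) (𝓝 (bmo p D G α ε₀ A (unitCube n))) := by
      have hc : Continuous fun ε : ℝ => (1 - ε / ε₀) ^ n := by fun_prop
      have h2 := (ENNReal.continuous_ofReal.comp hc).tendsto 0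
      simp only [Function.comp_apply, zero_div, sub_zero, one_pow, ENNReal.ofReal_one] at h2
      have := ENNReal.Tendsto.mul_const (b := bmo p D G α ε₀ A (unitCube n))
        (h2.mono_left (nhdsWithin_le_nhds (s := Set.Ioi 0))) (Or.inl one_ne_zero)
      simpa using this
    calc bmo p D G α ε₀ A (unitCube n) = liminf (fun ε : ℝ => ENNReal.ofReal ((1 - ε / ε₀) ^ n) *
        bmo p D G α ε₀ A (unitCube n)) (𝓝[>] 0) := hlim.liminf_eq.symm
      _ ≤ _ := liminf_le_liminf hev
  · refine limsup_le_of_le (by isBoundedDefault) ?_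
    filter_upwards [self_mem_nhdsWithin] with ε hε
    exact le_iSup (fun ε : Set.Ioi (0 : ℝ) => bmo p D G α ε A (unitCube n)) ⟨ε, hε⟩

theorem psi_eq_iSup (hα : IsCoreFunctional p D (similarityGroup G) α) (hp : 1 < p)
    (A : Mat m n) :
    psi p D G α A = ⨆ ε : Set.Ioi (0 : ℝ), bmo p D G α ε A (unitCube n) :=
  (tendsto_bmo_unitCube hα hp A).limUnder_eq

theorem psi_lt_top (hα : IsCoreFunctional p D (similarityGroup G) α) (hp : 1 < p)
    (hD : IsOpen D) (hDb : Bornology.IsBounded D) (A : Mat m n) : psi p D G α A < ⊤ := by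
  obtain ⟨c₁, hc₁⟩ := exists_bmo_le hα hp hD hDb
  have : IsFiniteMeasure (volume.restrict (unitCube n)) :=
    isFiniteMeasure_restrict.2 (measure_unitCube_lt_top n).ne
  rw [psi_eq_iSup hα hp]
  refine lt_of_le_of_lt (iSup_le fun ε => hc₁ A (memLpLoc_of_continuous A.continuous) _
    (measurableSet_unitCube n) (fun _ => A) (memLp_const A) (hasWeakD_continuousLinearMap A _)
    ε ε.2) ENNReal.ofReal_lt_top

/-- The supremum vanishes iff every image in the cube contributes `0`. Each contribution is a
positive multiple of some `α(AR, D)`, and for every `R` a small enough copy fits in the cube. -/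
theorem psi_eq_zero_iff (hα : IsCoreFunctional p D (similarityGroup G) α) (hp : 1 < p)
    (hDb : Bornology.IsBounded D) (A : Mat m n) :
    psi p D G α A = 0 ↔ ∀ R ∈ G, α (A.comp (rotation R)) D = 0 := by
  rw [psi_eq_iSup hα hp, ENNReal.iSup_eq_zero]
  constructor
  · intro h R hR
    obtain ⟨r, hr⟩ := hDb.subset_closedBall 0
    -- With this choice `ε |r| < 1/2`, so the copy lies in the open cube.
    set ε : ℝ := (2 * (|r| + 1))⁻¹ with hε'
    have hr1 : 0 < |r| + 1 := by positivity
    have hε : 0 < ε := by positivity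
    have hεr : ε * (|r| + 1) = 1 / 2 := by rw [hε']; field_simp
    have hsub : similarity hε.ne' R 0 '' D ⊆ unitCube n := by
      rintro _ ⟨x, hx, rfl⟩ i
      rw [← abs_lt]
      have h1 : ‖x‖ ≤ |r| := (mem_closedBall_zero_iff.1 (hr hx)).trans (le_abs_self r)
      have h2 : ‖similarity hε.ne' R 0 x‖ = ε * ‖x‖ := by
        rw [similarity_apply, add_zero, norm_smul, norm_rotation_apply, Real.norm_of_nonneg hε.le]
      have h3 := PiLp.norm_apply_le (similarity hε.ne' R 0 x) i
      rw [h2, Real.norm_eq_abs] at h3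
      nlinarith
    have key := ofReal_mul_tsum_le_bmo hα hp (memLpLoc_of_continuous A.continuous)
      (fun _ : Unit => similarity hε.ne' R 0) (fun _ => similarity_mem hε.ne' hR 0)
      (fun _ => hsub) (fun i j hij => (hij rfl).elim)
    have h0 := h ⟨ε, hε⟩
    simp only [h0, nonpos_iff_eq_zero, mul_eq_zero, tsum_fintype, Finset.univ_unique,
      Finset.sum_singleton, ENNReal.coe_eq_zero, ENNReal.ofReal_eq_zero] at key
    have hv := hα.apply_continuousLinearMap_image A hε hR 0
    rcases key with key | key
    · exact absurd key (not_le.2 (Real.rpow_pos_of_pos hε _))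
    · rw [key, NNReal.coe_zero, eq_comm, mul_eq_zero] at hv
      rcases hv with hv | hv
      · exact absurd hv (Real.rpow_pos_of_pos hε _).ne'
      · exact_mod_cast hv
  · rintro h ⟨ε, hε⟩
    have hε : 0 < ε := hε
    have : ∀ 𝓕 : {𝓕 : Set (Set (E n)) // 𝓕 ⊆ images D (similarities G ε) (unitCube n) ∧
        𝓕.PairwiseDisjoint id}, ∑' D' : 𝓕.1, (α A D' : ℝ≥0∞) = 0 := by
      rintro ⟨𝓕, h𝓕, -⟩
      refine ENNReal.tsum_eq_zero.2 fun D' => ?_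
      obtain ⟨⟨F, hFG, hF⟩, -⟩ := h𝓕 D'.2
      obtain ⟨R, hR, h', rfl⟩ := eq_similarity hε.ne' hFG
      have hv := hα.apply_continuousLinearMap_image A hε hR h'
      rw [h R hR, NNReal.coe_zero, mul_zero, ← hF] at hv
      exact_mod_cast hv
    simp [bmo, this]

/-- The space of the matrices at which `ψ` vanishes. -/
def psiKernel (hα : IsCoreFunctional p D (similarityGroup G) α) (hp : 1 < p) :
    Submodule ℝ (Mat m n) where
  -- In this form linearity is visible: an intersection of null spaces of the seminorms `A ↦ α(AR,
  -- D)^{1/p}`.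
  carrier := {A | ∀ R ∈ G, α (A.comp (rotation R)) D = 0}
  zero_mem' := fun R _ => by
    have := hα.apply_zero hp
    simpa using this
  add_mem' := by
    intro A B hA hB R hR
    have h1 := hα.coreNorm_add_le hp
      (memLpLoc_of_continuous (A.comp (rotation R)).continuous)
      (memLpLoc_of_continuous (B.comp (rotation R)).continuous)
    have h0 : (0 : ℝ) ^ (1 / p) = 0 := Real.zero_rpow (by positivity)
    simp only [IsCoreFunctional.coreNorm, hA R hR, hB R hR, NNReal.coe_zero, h0, add_zero] at h1
    have h2 := (h1.antisymm (by positivity))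
    rw [Real.rpow_eq_zero (by positivity) (by positivity)] at h2
    exact_mod_cast h2
  smul_mem' := by
    intro c A hA R hR
    have h1 := hα.homogeneous D (self_mem_images D _) _
      (memLpLoc_of_continuous (A.comp (rotation R)).continuous) c
    rw [hA R hR, NNReal.coe_zero, mul_zero] at h1
    exact_mod_cast h1

theorem coe_psiKernel (hα : IsCoreFunctional p D (similarityGroup G) α) (hp : 1 < p)
    (hDb : Bornology.IsBounded D) :
    (psiKernel hα hp : Set (Mat m n)) = {A | psi p D G α A = 0} :=
  Set.ext fun A => (psi_eq_zero_iff hα hp hDb A).symm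

/-! ### Averages and their `L^p` bound. -/

/-- The lattice `ℤⁿ` in `ℝⁿ`. -/
def integerLattice (n : ℕ) : AddSubgroup (E n) :=
  (Submodule.span ℤ (Set.range (EuclideanSpace.basisFun (Fin n) ℝ).toBasis)).toAddSubgroup

theorem one_le_norm_of_mem_integerLattice {z : E n} (hz : z ∈ integerLattice n) (h0 : z ≠ 0) :
    1 ≤ ‖z‖ := by
  rw [integerLattice, Submodule.mem_toAddSubgroup, Module.Basis.mem_span_iff_repr_mem] at hz
  obtain ⟨i, hi⟩ : ∃ i, z i ≠ 0 := by
    by_contra! h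
    exact h0 (by ext i; simpa using h i)
  obtain ⟨k, hk⟩ := hz i
  have hk' : (k : ℝ) = z i := by simpa using hk
  refine le_trans ?_ (PiLp.norm_apply_le z i)
  rw [← hk', Real.norm_eq_abs]
  have : k ≠ 0 := fun h => hi (by rw [← hk', h]; simp)
  exact_mod_cast Int.one_le_abs this

/-- Unfolding: the integral over `ℝⁿ` is the integral of the periodized function over a fundamental
cell, and `V` is the volume of that cell. -/
theorem exists_lintegral_le_of_tsum_integerLattice_le (n : ℕ) :
    ∃ V : ℝ≥0, ∀ f : E n → ℝ≥0∞, AEMeasurable f volume → ∀ C : ℝ≥0∞,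
      (∀ x, ∑' z : integerLattice n, f ((z : E n) + x) ≤ C) → ∫⁻ x, f x ≤ V * C := by
  set b := (EuclideanSpace.basisFun (Fin n) ℝ).toBasis with hb
  have hfin : volume (ZSpan.fundamentalDomain b) < ⊤ :=
    (ZSpan.fundamentalDomain_isBounded b).measure_lt_top
  refine ⟨(volume (ZSpan.fundamentalDomain b)).toNNReal, fun f hf C hC => ?_⟩
  have hfd : IsAddFundamentalDomain (integerLattice n) (ZSpan.fundamentalDomain b) volume :=
    ZSpan.isAddFundamentalDomain' b volume
  have : Countable (integerLattice n) := by
    change Countable (Submodule.span ℤ (Set.range b))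
    infer_instance
  rw [hfd.lintegral_eq_tsum'', ← lintegral_tsum]
  · calc ∫⁻ x in ZSpan.fundamentalDomain b, ∑' z : integerLattice n, f (z +ᵥ x)
        ≤ ∫⁻ _ in ZSpan.fundamentalDomain b, C := lintegral_mono fun x => hC x
      _ = _ := by
        rw [lintegral_const, Measure.restrict_apply_univ, ENNReal.coe_toNNReal hfin.ne, mul_comm]
  · intro z
    exact (hf.comp_quasiMeasurePreserving
      (measurePreserving_add_left volume (z : E n)).quasiMeasurePreserving).restrict

/-- The averages `x ↦ ∫_D ⟪u (ε R y + x), w y⟫ dy`. -/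
def average (D : Set (E n)) (w u : E n → E m) (R : Matrix.specialOrthogonalGroup (Fin n) ℝ)
    (ε : ℝ) (x : E n) : ℝ :=
  ∫ y in D, ⟪u (ε • rotation R y + x), w y⟫

/-- The shear `(y, x) ↦ (y, ε R y + x)`. -/
theorem measurePreserving_shear (D : Set (E n)) (R : Matrix.specialOrthogonalGroup (Fin n) ℝ)
    (ε : ℝ) :
    MeasurePreserving (fun z : E n × E n => (z.1, ε • rotation R z.1 + z.2))
      ((volume.restrict D).prod volume) ((volume.restrict D).prod volume) := by
  refine (MeasurePreserving.id _).skew_product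
    (g := fun y x : E n => ε • rotation R y + x) ?_ (ae_of_all _ fun y => ?_)
  · have : Continuous (Function.uncurry fun y x : E n => ε • rotation R y + x) := by
      unfold Function.uncurry; fun_prop
    exact this.measurable
  · exact (measurePreserving_add_left volume _).map_eq

theorem aestronglyMeasurable_inner_prod {u w : E n → E m} (hu : AEStronglyMeasurable u volume)
    (hw : AEStronglyMeasurable w volume) (D : Set (E n)) :
    AEStronglyMeasurable (fun z : E n × E n => ⟪u z.2, w z.1⟫)
      ((volume.restrict D).prod volume) :=
  (hu.comp_snd).inner (hw.restrict.comp_fst)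

theorem aestronglyMeasurable_average {u w : E n → E m} (hu : AEStronglyMeasurable u volume)
    (hw : AEStronglyMeasurable w volume) (D : Set (E n))
    (R : Matrix.specialOrthogonalGroup (Fin n) ℝ) (ε : ℝ) :
    AEStronglyMeasurable (average D w u R ε) volume :=
  ((aestronglyMeasurable_inner_prod hu hw D).comp_measurePreserving
    (measurePreserving_shear D R ε)).prod_swap.integral_prod_right'

/-- Pointwise, `|average|^p` is at most `α(u, εRD + x)`. Along each coset of a lattice of mesh `a =
εL` the copies are disjoint, so the sum is at most `ε^{p-n} G_ε(u, Ω)`; the cell volume, of order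
`a^n`, turns this into `ε^p`. -/
theorem exists_lintegral_rpow_average_le (hα : IsCoreFunctional p D (similarityGroup G) α)
    (hp : 1 < p) (hDb : Bornology.IsBounded D) {w : E n → E m}
    (hwm : AEStronglyMeasurable w volume)
    (hw : ∀ v, MemLpLoc p v → |∫ x in D, ⟪v x, w x⟫| ^ p ≤ α v D)
    {R : Matrix.specialOrthogonalGroup (Fin n) ℝ} (hR : R ∈ G) :
    ∃ C : ℝ, 0 ≤ C ∧ ∀ u : E n → E m, MemLpLoc p u → ∀ Ω K : Set (E n), MeasurableSet K →
      ∀ (ε : ℝ) (hε : 0 < ε), (∀ x ∈ K, similarity hε.ne' R x '' D ⊆ Ω) →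
      ∫⁻ x in K, ‖average D w u R ε x‖ₑ ^ p ≤ ENNReal.ofReal (C * ε ^ p) * bmo p D G α ε u Ω := by
  have hp0 : 0 < p := by linarith
  obtain ⟨V, hV⟩ := exists_lintegral_le_of_tsum_integerLattice_le n
  obtain ⟨r, hr⟩ := hDb.subset_closedBall 0
  -- `D` has diameter at most `2|r|`; the extra `1` makes the mesh `εL` strictly larger than the
  -- diameter of a copy.
  set L : ℝ := 2 * |r| + 1 with hL
  have hL0 : 0 < L := by positivity
  refine ⟨V * L ^ n, by positivity, fun u hu Ω K hK ε hε hsub => ?_⟩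
  set a := ε * L with ha
  have ha0 : 0 < a := mul_pos hε hL0
  set f : E n → ℝ≥0∞ := K.indicator fun x => ‖average D w u R ε x‖ₑ ^ p with hf
  have hum := (hu.locallyIntegrable hp.le).aestronglyMeasurable
  have hfm : AEMeasurable f volume :=
    ((aestronglyMeasurable_average hum hwm D R ε).enorm.pow_const p).indicator hK
  have hval : ∀ x, ‖average D w u R ε x‖ₑ ^ p ≤ α u (similarity hε.ne' R x '' D) := fun x => by
    have h1 := hw _ (hu.comp_similarity hε R x)
    rw [hα.apply_image hu (mem_similarityGroup_of_mem hε (similarity_mem hε.ne' hR x)),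
      ← ofReal_norm, ENNReal.ofReal_rpow_of_nonneg (norm_nonneg _) hp0.le,
      ← ENNReal.ofReal_coe_nnreal]
    refine ENNReal.ofReal_le_ofReal (le_trans (le_of_eq ?_) h1)
    simp only [Real.norm_eq_abs, average, Function.comp_apply, similarity_apply]
  have hscale : ∫⁻ x, f x = ENNReal.ofReal (a ^ n) * ∫⁻ x, f (a • x) := by
    have hmap := Measure.map_addHaar_smul (volume : Measure (E n)) ha0.ne'
    have hemb : MeasurableEmbedding fun x : E n => a • x :=
      (Homeomorph.smulOfNeZero a ha0.ne').measurableEmbedding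
    rw [← hemb.lintegral_map, hmap, lintegral_smul_measure, smul_eq_mul, ← mul_assoc,
      ← ENNReal.ofReal_mul (by positivity), finrank_euclideanSpace_fin,
      abs_of_pos (by positivity), mul_inv_cancel₀ (by positivity), ENNReal.ofReal_one, one_mul]
  have hsum : ∀ x, ∑' z : integerLattice n, f (a • ((z : E n) + x)) ≤
      ENNReal.ofReal (ε ^ (p - n)) * bmo p D G α ε u Ω := fun x => by
    -- Only centres in `K` are kept: their copies lie in `Ω`, and `f` vanishes at the others.
    let Z : Set (integerLattice n) := {z | a • ((z : E n) + x) ∈ K}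
    have h1 : ∑' z : integerLattice n, f (a • ((z : E n) + x)) ≤
        ∑' z : Z, (α u (similarity hε.ne' R (a • (((z : integerLattice n) : E n) + x)) '' D) :
          ℝ≥0∞) := by
      rw [tsum_subtype Z fun z => (α u (similarity hε.ne' R (a • ((z : E n) + x)) '' D) : ℝ≥0∞)]
      refine ENNReal.tsum_le_tsum fun z => ?_
      by_cases hz : a • ((z : E n) + x) ∈ K
      · rw [hf, Set.indicator_of_mem hz, Set.indicator_of_mem (show z ∈ Z from hz)]
        exact hval _
      · rw [hf, Set.indicator_of_notMem hz]
        exact zero_le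
    have h2 := ofReal_mul_tsum_le_bmo hα hp hu (Ω := Ω)
      (fun z : Z => similarity hε.ne' R (a • (((z : integerLattice n) : E n) + x)))
      (fun z => similarity_mem hε.ne' hR _) (fun z => hsub _ z.2) (by
        intro z z' hzz
        simp only [Function.onFun]
        rw [Set.disjoint_left]
        rintro _ ⟨y, hy, rfl⟩ ⟨y', hy', e⟩
        rw [similarity_apply, similarity_apply] at e
        have hne : ((z : integerLattice n) : E n) - ((z' : integerLattice n) : E n) ≠ 0 :=
          fun h => hzz (Subtype.ext (Subtype.ext (sub_eq_zero.1 h)))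
        have h3 := one_le_norm_of_mem_integerLattice
          (sub_mem (z : integerLattice n).2 (z' : integerLattice n).2) hne
        have h4 : a • (((z : integerLattice n) : E n) - ((z' : integerLattice n) : E n)) =
            ε • rotation R (y' - y) := by
          rw [map_sub, smul_sub, smul_sub]
          rw [smul_add, smul_add, ← sub_eq_zero] at e
          rw [← sub_eq_zero, ← neg_eq_zero, ← e]
          abel
        have h5 := congrArg norm h4
        rw [norm_smul, norm_smul, norm_rotation_apply, Real.norm_of_nonneg ha0.le,
          Real.norm_of_nonneg hε.le] at h5
        have h6 : ‖y' - y‖ ≤ 2 * |r| := by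
          have := norm_sub_le y' y
          have a1 := (mem_closedBall_zero_iff.1 (hr hy)).trans (le_abs_self r)
          have a2 := (mem_closedBall_zero_iff.1 (hr hy')).trans (le_abs_self r)
          linarith
        have h7 : ε * ‖y' - y‖ ≤ ε * (2 * |r|) := mul_le_mul_of_nonneg_left h6 hε.le
        have h8 : a * 1 ≤ a * ‖((z : integerLattice n) : E n) - ((z' : integerLattice n) : E n)‖ :=
          mul_le_mul_of_nonneg_left h3 ha0.le
        rw [ha, hL] at h8
        nlinarith)
    refine h1.trans ?_
    refine le_trans (le_of_eq ?_) (mul_le_mul_right h2 _)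
    rw [← mul_assoc, ← ENNReal.ofReal_mul (by positivity), ← Real.rpow_add hε]
    simp
  have hmain := hV (fun x => f (a • x)) (hfm.comp_quasiMeasurePreserving
    (Measure.quasiMeasurePreserving_smul _ ha0.ne')) _ hsum
  rw [← lintegral_indicator hK, ← hf, hscale]
  refine (mul_le_mul_right hmain _).trans_eq ?_
  rw [← mul_assoc, ← mul_assoc]
  congr 1
  rw [← ENNReal.ofReal_coe_nnreal, ← ENNReal.ofReal_mul (by positivity),
    ← ENNReal.ofReal_mul (by positivity)]
  congr 1
  rw [ha, Real.rpow_sub hε, Real.rpow_natCast, mul_pow]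
  field_simp

/-! ### The distributional limit of the averages. -/

theorem integrableOn_inner_rotation (hD : MeasurableSet D) (hDb : Bornology.IsBounded D)
    {w : E n → E m} (hw : IntegrableOn w D) (R : Matrix.specialOrthogonalGroup (Fin n) ℝ)
    (A : Mat m n) : IntegrableOn (fun y => ⟪A (rotation R y), w y⟫) D := by
  obtain ⟨r, hr⟩ := hDb.subset_closedBall 0
  have hc : Continuous fun y => A (rotation R y) := by fun_prop
  refine Integrable.mono' (hw.norm.const_mul (‖A‖ * |r|))
    (hc.aestronglyMeasurable.inner hw.aestronglyMeasurable) ?_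
  filter_upwards [ae_restrict_mem hD] with y hy
  refine (norm_inner_le_norm _ _).trans (mul_le_mul_of_nonneg_right ?_ (norm_nonneg _))
  refine (A.le_opNorm _).trans (mul_le_mul_of_nonneg_left ?_ (norm_nonneg _))
  rw [norm_rotation_apply]
  exact (mem_closedBall_zero_iff.1 (hr hy)).trans (le_abs_self r)

/-- The functional `A ↦ ∫_D ⟪A R y, w y⟫ dy`. -/
def momentFunctional (hD : MeasurableSet D) (hDb : Bornology.IsBounded D)
    {w : E n → E m} (hw : IntegrableOn w D) (R : Matrix.specialOrthogonalGroup (Fin n) ℝ) :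
    Mat m n →ₗ[ℝ] ℝ where
  toFun A := ∫ y in D, ⟪A (rotation R y), w y⟫
  map_add' A B := by
    rw [← integral_add (integrableOn_inner_rotation hD hDb hw R A)
      (integrableOn_inner_rotation hD hDb hw R B)]
    simp [inner_add_left]
  map_smul' c A := by
    rw [RingHom.id_apply, smul_eq_mul, ← integral_const_mul]
    simp [inner_smul_left]

/-- Fubini and the shear move the shift onto the test function, giving `∬ φ(x - εRy) ⟪u(x), w(y)⟫`.
Since `w` has mean zero, `φ(x)` may be subtracted, and the difference quotients tend to `-∇φ(x)·Ry`
under a common integrable bound. -/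
theorem tendsto_integral_average (hD : MeasurableSet D) (hDb : Bornology.IsBounded D)
    {w : E n → E m} (hw : IntegrableOn w D) (hwm : AEStronglyMeasurable w volume)
    (hconst : ∀ c : E m, ∫ y in D, ⟪c, w y⟫ = 0) {u : E n → E m}
    (hu : LocallyIntegrable u volume) (R : Matrix.specialOrthogonalGroup (Fin n) ℝ)
    {φ : E n → ℝ} (hφ : ContDiff ℝ ((⊤ : ℕ∞) : WithTop ℕ∞) φ) (hc : HasCompactSupport φ) :
    Tendsto (fun ε : ℝ => ε⁻¹ * ∫ x, φ x * average D w u R ε x) (𝓝[>] 0)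
      (𝓝 (-∫ x, momentFunctional hD hDb hw R (tensorGrad u φ x))) := by
  obtain ⟨r', hr'⟩ := hDb.subset_closedBall 0
  set r : ℝ := |r'| with hrdef
  have hr : ∀ y ∈ D, ‖y‖ ≤ r := fun y hy =>
    (mem_closedBall_zero_iff.1 (hr' hy)).trans (le_abs_self r')
  have hr0 : 0 ≤ r := abs_nonneg r'
  obtain ⟨ρ, hρ⟩ := hc.isCompact.isBounded.subset_closedBall 0
  have hρ' : ∀ x, ρ < ‖x‖ → x ∉ tsupport φ := fun x hx h =>
    absurd (mem_closedBall_zero_iff.1 (hρ h)) (not_le.2 hx)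
  have hd : Differentiable ℝ φ := hφ.differentiable (by simp)
  have hcont : Continuous (fderiv ℝ φ) := hφ.continuous_fderiv (by simp)
  obtain ⟨M, hM⟩ := hcont.bounded_above_of_compact_support (hc.fderiv ℝ)
  have hM0 : 0 ≤ M := (norm_nonneg _).trans (hM 0)
  obtain ⟨M₀, hM₀⟩ := hφ.continuous.bounded_above_of_compact_support hc
  set ν := (volume.restrict D).prod (volume : Measure (E n)) with hν
  -- For `0 ≤ ε ≤ 1` and `y ∈ D`, this ball contains the supports of all shifted test functions.
  set B := Metric.closedBall (0 : E n) (ρ + r) with hB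
  have hB0 : ∀ x, x ∉ B → ∀ y ∈ D, ∀ ε : ℝ, 0 ≤ ε → ε ≤ 1 →
      x - ε • rotation R y ∉ tsupport φ := fun x hx y hy ε h0 h1 => by
    refine hρ' _ ?_
    have hx' : ρ + r < ‖x‖ := by simpa [hB] using hx
    have := norm_sub_norm_le x (ε • rotation R y)
    rw [norm_smul, norm_rotation_apply, Real.norm_of_nonneg h0] at this
    have h2 : ε * ‖y‖ ≤ 1 * r := mul_le_mul h1 (hr y hy) (norm_nonneg _) zero_le_one
    linarith
  have hB1 : ∀ x, x ∉ B → x ∉ tsupport φ := fun x hx => by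
    refine hρ' _ ?_
    have hx' : ρ + r < ‖x‖ := by simpa [hB] using hx
    linarith
  have hDae : ∀ᵐ z ∂ν, z.1 ∈ D :=
    Measure.quasiMeasurePreserving_fst.ae (ae_restrict_mem hD)
  let k : E n × E n → ℝ := fun z => ⟪u z.2, w z.1⟫
  have hkm : AEStronglyMeasurable k ν :=
    aestronglyMeasurable_inner_prod hu.aestronglyMeasurable hwm D
  let dom : E n × E n → ℝ := fun z => ‖w z.1‖ * B.indicator (fun x => ‖u x‖) z.2
  have hdom : Integrable dom ν := by
    refine Integrable.mul_prod hw.norm ?_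
    rw [integrable_indicator_iff measurableSet_closedBall]
    exact (hu.integrableOn_isCompact (isCompact_closedBall _ _)).norm
  have hk : ∀ (c C : ℝ) (z : E n × E n), |c| ≤ C → (z.2 ∉ B → c = 0) →
      ‖c * k z‖ ≤ C * dom z := fun c C z hcC hc0 => by
    by_cases hz : z.2 ∈ B
    · simp only [dom, Set.indicator_of_mem hz, norm_mul, Real.norm_eq_abs c]
      refine mul_le_mul hcC ?_ (norm_nonneg _) ((abs_nonneg _).trans hcC)
      rw [mul_comm]
      exact norm_inner_le_norm _ _
    · simp [dom, hc0 hz, hz]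
  have hdomint : ∀ (c : E n × E n → ℝ) (C : ℝ), Continuous c →
      (∀ z, z.1 ∈ D → |c z| ≤ C ∧ (z.2 ∉ B → c z = 0)) → Integrable (fun z => c z * k z) ν :=
    fun c C hcc h => by
      refine (hdom.const_mul C).mono' (hcc.aestronglyMeasurable.mul hkm) ?_
      filter_upwards [hDae] with z hz
      exact hk _ _ _ (h z hz).1 (h z hz).2
  have hΦi : ∀ ε : ℝ, 0 ≤ ε → ε ≤ 1 →
      Integrable (fun z : E n × E n => φ (z.2 - ε • rotation R z.1) * k z) ν := fun ε h0 h1 => by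
    refine hdomint (fun z => φ (z.2 - ε • rotation R z.1)) M₀ ?_ fun z hz => ⟨hM₀ _, fun hzB =>
      image_eq_zero_of_notMem_tsupport (hB0 _ hzB _ hz _ h0 h1)⟩
    have := hφ.continuous
    fun_prop
  -- Mean zero of `w` enters here, against the constant vector `∫ φ u`.
  have hφk : ∫ z, φ z.2 * k z ∂ν = 0 := by
    have hi := hΦi 0 le_rfl zero_le_one
    simp only [zero_smul, sub_zero] at hi
    rw [integral_prod _ hi]
    have : ∀ y, ∫ x, φ x * ⟪u x, w y⟫ = ⟪∫ x, φ x • u x, w y⟫ := fun y => by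
      rw [real_inner_comm, ← integral_inner
        (hu.integrable_smul_left_of_hasCompactSupport hφ.continuous hc)]
      simp [inner_smul_right, real_inner_comm]
    simp only [k, this]
    exact hconst _
  have havg : ∀ ε : ℝ, 0 ≤ ε → ε ≤ 1 → ∫ x, φ x * average D w u R ε x =
      ∫ z, φ (z.2 - ε • rotation R z.1) * k z ∂ν := fun ε h0 h1 => by
    have hS := measurePreserving_shear D R ε
    have hi := hΦi ε h0 h1
    have hi' := hS.integrable_comp_of_integrable hi
    have e1 : ∫ z, φ (z.2 - ε • rotation R z.1) * k z ∂ν =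
        ∫ z, φ z.2 * ⟪u (ε • rotation R z.1 + z.2), w z.1⟫ ∂ν := by
      conv_lhs => rw [hν, ← hS.map_eq]
      rw [integral_map hS.aemeasurable (by rw [hS.map_eq]; exact hi.aestronglyMeasurable)]
      simp only [k, add_sub_cancel_left]
      rfl
    rw [e1, integral_prod_symm]
    · refine integral_congr_ae (ae_of_all _ fun x => ?_)
      simp only [average]
      rw [← integral_const_mul]
    · refine hi'.congr (ae_of_all _ fun z => ?_)
      simp [k]
  have hquot : ∀ᶠ ε in 𝓝[>] (0 : ℝ), ε⁻¹ * ∫ x, φ x * average D w u R ε x =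
      ∫ z, (ε⁻¹ * (φ (z.2 - ε • rotation R z.1) - φ z.2)) * k z ∂ν := by
    have h1 : ∀ᶠ ε in 𝓝[>] (0 : ℝ), ε < 1 :=
      (eventually_lt_nhds one_pos).filter_mono nhdsWithin_le_nhds
    filter_upwards [self_mem_nhdsWithin, h1] with ε h0 h1
    have h0 : 0 < ε := h0
    have hi := hΦi 0 le_rfl zero_le_one
    simp only [zero_smul, sub_zero] at hi
    rw [havg ε h0.le h1.le, ← sub_zero (∫ z, φ (z.2 - ε • rotation R z.1) * k z ∂ν), ← hφk,
      ← integral_sub (hΦi ε h0.le h1.le) hi, ← integral_const_mul]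
    refine integral_congr_ae (ae_of_all _ fun z => ?_)
    ring
  have hlim : ∫ z, (-(fderiv ℝ φ z.2 (rotation R z.1))) * k z ∂ν =
      -∫ x, momentFunctional hD hDb hw R (tensorGrad u φ x) := by
    rw [integral_prod_symm, ← integral_neg]
    · refine integral_congr_ae (ae_of_all _ fun x => ?_)
      simp only [momentFunctional, LinearMap.coe_mk, AddHom.coe_mk]
      rw [← integral_neg]
      refine integral_congr_ae (ae_of_all _ fun y => ?_)
      simp [tensorGrad, k, inner_smul_left]
    · refine hdomint (fun z => -(fderiv ℝ φ z.2 (rotation R z.1))) (M * r) ?_ fun z hz =>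
        ⟨?_, fun hzB => ?_⟩
      · have : Continuous fun z : E n × E n => fderiv ℝ φ z.2 (rotation R z.1) :=
          (hcont.comp continuous_snd).clm_apply ((rotation R).continuous.comp continuous_fst)
        exact this.neg
      · rw [abs_neg, ← Real.norm_eq_abs]
        refine (ContinuousLinearMap.le_opNorm _ _).trans ?_
        rw [norm_rotation_apply]
        exact mul_le_mul (hM _) (hr _ hz) (norm_nonneg _) hM0
      · have : fderiv ℝ φ z.2 = 0 := by
          by_contra h
          exact hB1 _ hzB (support_fderiv_subset ℝ h)
        simp [this]
  rw [tendsto_congr' hquot, ← hlim]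
  refine tendsto_integral_filter_of_dominated_convergence (fun z => M * r * dom z) ?_ ?_
    (hdom.const_mul _) ?_
  · refine Eventually.of_forall fun ε => AEStronglyMeasurable.mul ?_ hkm
    have : Continuous fun z : E n × E n => ε⁻¹ * (φ (z.2 - ε • rotation R z.1) - φ z.2) := by
      have := hφ.continuous
      fun_prop
    exact this.aestronglyMeasurable
  · have h1 : ∀ᶠ ε in 𝓝[>] (0 : ℝ), ε < 1 :=
      (eventually_lt_nhds one_pos).filter_mono nhdsWithin_le_nhds
    filter_upwards [self_mem_nhdsWithin, h1] with ε h0 h1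
    have h0 : 0 < ε := h0
    filter_upwards [hDae] with z hz
    refine hk _ _ _ ?_ fun hzB => ?_
    -- The mean value inequality bounds the quotient by `M r`, uniformly in `ε`.
    · have := Convex.norm_image_sub_le_of_norm_fderiv_le (𝕜 := ℝ) (f := φ) (s := Set.univ)
        (fun x _ => hd x) (fun x _ => hM x) convex_univ (Set.mem_univ z.2)
        (Set.mem_univ (z.2 - ε • rotation R z.1))
      rw [sub_sub_cancel_left, norm_neg, norm_smul, norm_rotation_apply,
        Real.norm_of_nonneg h0.le, Real.norm_eq_abs] at this
      rw [abs_mul, abs_of_pos (inv_pos.2 h0), inv_mul_le_iff₀ h0]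
      refine this.trans ?_
      rw [mul_left_comm]
      exact mul_le_mul_of_nonneg_left (mul_le_mul_of_nonneg_left (hr _ hz) hM0) h0.le
    · rw [image_eq_zero_of_notMem_tsupport (hB0 _ hzB _ hz ε h0.le h1.le),
        image_eq_zero_of_notMem_tsupport (hB1 _ hzB), sub_zero, mul_zero]
  · refine ae_of_all _ fun z => Tendsto.mul_const _ ?_
    have hder : HasDerivAt (fun t : ℝ => φ (z.2 - t • rotation R z.1))
        (-(fderiv ℝ φ z.2 (rotation R z.1))) 0 := by
      have h1 : HasDerivAt (fun t : ℝ => z.2 - t • rotation R z.1) (-(rotation R z.1)) 0 := by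
        simpa using ((hasDerivAt_id (0 : ℝ)).smul_const (rotation R z.1)).const_sub z.2
      have h2 : HasFDerivAt φ (fderiv ℝ φ z.2) (z.2 - (0 : ℝ) • rotation R z.1) := by
        simpa using (hd z.2).hasFDerivAt
      rw [← map_neg]
      exact h2.comp_hasDerivAt (0 : ℝ) h1
    have hsub : Set.Ioi (0 : ℝ) ⊆ {0}ᶜ := fun x hx => (Set.mem_Ioi.1 hx).ne'
    have := (hasDerivAt_iff_tendsto_slope_zero.1 hder).mono_left (nhdsWithin_mono (0 : ℝ) hsub)
    simpa using this

/-! ### Functionals of the gradient that lie in `L^p`. -/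

/-- The smooth functions with compact support in `Ω`. -/
def testFunctions (Ω : Set (E n)) : Submodule ℝ (E n → ℝ) where
  carrier := {φ | ContDiff ℝ ((⊤ : ℕ∞) : WithTop ℕ∞) φ ∧ HasCompactSupport φ ∧ tsupport φ ⊆ Ω}
  zero_mem' := ⟨contDiff_const, HasCompactSupport.zero, by simp [tsupport]⟩
  add_mem' := fun {φ ψ} h h' => ⟨h.1.add h'.1, h.2.1.add h'.2.1,
    (tsupport_add φ ψ).trans (Set.union_subset h.2.2 h'.2.2)⟩
  smul_mem' := fun c φ h => ⟨h.1.const_smul c, h.2.1.smul_left (f := fun _ => c),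
    (tsupport_smul_subset_right (fun _ => c) φ).trans h.2.2⟩

theorem tensorGrad_add (u : E n → E m) {φ ψ : E n → ℝ}
    (hφ : ContDiff ℝ ((⊤ : ℕ∞) : WithTop ℕ∞) φ) (hψ : ContDiff ℝ ((⊤ : ℕ∞) : WithTop ℕ∞) ψ)
    (x : E n) : tensorGrad u (φ + ψ) x = tensorGrad u φ x + tensorGrad u ψ x := by
  rw [tensorGrad, fderiv_add (hφ.differentiable (by simp) x) (hψ.differentiable (by simp) x)]
  ext v
  simp [tensorGrad, add_mul]

theorem tensorGrad_smul (u : E n → E m) (c : ℝ) {φ : E n → ℝ}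
    (hφ : ContDiff ℝ ((⊤ : ℕ∞) : WithTop ℕ∞) φ) (x : E n) :
    tensorGrad u (c • φ) x = c • tensorGrad u φ x := by
  rw [tensorGrad, fderiv_const_smul (hφ.differentiable (by simp) x)]
  ext v
  simp [tensorGrad, mul_assoc]

theorem integrable_comp_tensorGrad {u : E n → E m} (hu : LocallyIntegrable u volume)
    (T : Mat m n →ₗ[ℝ] ℝ) {φ : E n → ℝ} (hφ : ContDiff ℝ ((⊤ : ℕ∞) : WithTop ℕ∞) φ)
    (hc : HasCompactSupport φ) : Integrable (fun x => T (tensorGrad u φ x)) volume :=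
  (LinearMap.toContinuousLinearMap T).integrable_comp (LocallyIntegrable.tensorGrad hu hφ hc)

theorem integrable_mul_of_memLp (hp : 1 < p) {Ω : Set (E n)} {g : E n → ℝ}
    (hg : MemLp g (ENNReal.ofReal p) (volume.restrict Ω)) {φ : E n → ℝ} (hφ : Continuous φ)
    (hc : HasCompactSupport φ) : Integrable (fun x => φ x * g x) (volume.restrict Ω) :=
  (hg.locallyIntegrable (ENNReal.one_le_ofReal.2 hp.le)).integrable_smul_left_of_hasCompactSupport
    hφ hc

/-- The functionals `T` for which the distribution `T (∇ u)` belongs to `L^p(Ω)`. -/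
def gradientFunctionals (hp : 1 < p) (Ω : Set (E n)) {u : E n → E m}
    (hu : LocallyIntegrable u volume) : Submodule ℝ (Module.Dual ℝ (Mat m n)) where
  carrier := {T | ∃ g : E n → ℝ, MemLp g (ENNReal.ofReal p) (volume.restrict Ω) ∧
    ∀ φ ∈ testFunctions Ω, ∫ x in Ω, φ x * g x = -∫ x in Ω, T (tensorGrad u φ x)}
  zero_mem' := ⟨0, MemLp.zero, fun φ _ => by simp⟩
  add_mem' := by
    rintro S T ⟨g, hg, hgS⟩ ⟨h, hh, hhT⟩
    refine ⟨g + h, hg.add hh, fun φ hφ => ?_⟩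
    simp only [Pi.add_apply, mul_add, LinearMap.add_apply]
    rw [integral_add (integrable_mul_of_memLp hp hg hφ.1.continuous hφ.2.1)
      (integrable_mul_of_memLp hp hh hφ.1.continuous hφ.2.1),
      integral_add (integrable_comp_tensorGrad hu S hφ.1 hφ.2.1).restrict
      (integrable_comp_tensorGrad hu T hφ.1 hφ.2.1).restrict, hgS φ hφ, hhT φ hφ, neg_add]
  smul_mem' := by
    rintro c T ⟨g, hg, hgT⟩
    refine ⟨c • g, hg.const_smul c, fun φ hφ => ?_⟩
    simp only [Pi.smul_apply, LinearMap.smul_apply, smul_eq_mul, mul_left_comm _ c]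
    rw [integral_const_mul, integral_const_mul, hgT φ hφ, mul_neg]

/-- The distribution is bounded in the `L^q` norm of the test function, so it extends to a
continuous functional on `L^q(Ω)`, and Riesz representation supplies the density in `L^p`. -/
theorem mem_gradientFunctionals_of_enorm_le (hp : 1 < p) {q : ℝ} (hpq : p.HolderConjugate q)
    {Ω : Set (E n)} {u : E n → E m} (hu : LocallyIntegrable u volume) {T : Mat m n →ₗ[ℝ] ℝ}
    {C : ℝ} (hC : 0 ≤ C) (h : ∀ φ ∈ testFunctions Ω, ‖∫ x in Ω, T (tensorGrad u φ x)‖ₑ ≤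
      ENNReal.ofReal C * eLpNorm φ (ENNReal.ofReal q) (volume.restrict Ω)) :
    T ∈ gradientFunctionals hp Ω hu := by
  have : Fact (1 ≤ ENNReal.ofReal q) := ⟨ENNReal.one_le_ofReal.2 hpq.symm.lt.le⟩
  have hmem : ∀ φ : testFunctions Ω, MemLp φ.1 (ENNReal.ofReal q) (volume.restrict Ω) := fun φ =>
    (φ.2.1.continuous.memLp_of_hasCompactSupport φ.2.2.1).restrict Ω
  let J : testFunctions Ω →ₗ[ℝ] Lp ℝ (ENNReal.ofReal q) (volume.restrict Ω) :=
    { toFun := fun φ => (hmem φ).toLp φ.1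
      map_add' := fun φ ψ => rfl
      map_smul' := fun c φ => rfl }
  have hi := fun φ : testFunctions Ω => integrable_comp_tensorGrad hu T φ.2.1 φ.2.2.1
  let Λ : testFunctions Ω →ₗ[ℝ] ℝ :=
    { toFun := fun φ => -∫ x in Ω, T (tensorGrad u φ.1 x)
      map_add' := fun φ ψ => by
        rw [← neg_add, ← integral_add (hi φ).restrict (hi ψ).restrict]
        simp [tensorGrad_add u φ.2.1 ψ.2.1]
      map_smul' := fun c φ => by
        rw [RingHom.id_apply, smul_eq_mul, mul_neg, ← integral_const_mul]
        simp [tensorGrad_smul u c φ.2.1] }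
  obtain ⟨l, hl⟩ := exists_continuousLinearMap_forall_apply_eq_of_abs_le J Λ hC fun φ => by
    have h1 := h φ.1 φ.2
    change |(-∫ x in Ω, T (tensorGrad u φ.1 x))| ≤ C * ‖(hmem φ).toLp φ.1‖
    rw [abs_neg, ← Real.norm_eq_abs, Lp.norm_toLp, ← toReal_enorm,
      ← ENNReal.toReal_ofReal hC, ← ENNReal.toReal_mul]
    exact ENNReal.toReal_mono (ENNReal.mul_ne_top ENNReal.ofReal_ne_top (hmem φ).2.ne) h1
  obtain ⟨g, hg, hrep⟩ := exists_memLp_forall_apply_eq_integral hpq l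
  refine ⟨g, hg, fun φ hφ => ?_⟩
  have h1 := hl ⟨φ, hφ⟩
  rw [hrep] at h1
  refine Eq.trans (integral_congr_ae ?_) h1
  filter_upwards [(hmem ⟨φ, hφ⟩).coeFn_toLp] with x hx
  change φ x * g x = ((hmem ⟨φ, hφ⟩).toLp φ) x * g x
  rw [hx]

theorem exists_forall_similarity_image_subset (hDb : Bornology.IsBounded D) {Ω K : Set (E n)}
    (hΩ : IsOpen Ω) (hK : IsCompact K) (hKΩ : K ⊆ Ω)
    (R : Matrix.specialOrthogonalGroup (Fin n) ℝ) :
    ∀ᶠ ε in 𝓝[>] (0 : ℝ), ∃ hε : 0 < ε, ∀ x ∈ K, similarity hε.ne' R x '' D ⊆ Ω := by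
  obtain ⟨r, hr⟩ := hDb.subset_closedBall 0
  obtain ⟨δ, hδ, hsub⟩ := hK.exists_thickening_subset_open hΩ hKΩ
  have h1 : ∀ᶠ ε in 𝓝[>] (0 : ℝ), ε < δ / (|r| + 1) :=
    (eventually_lt_nhds (by positivity)).filter_mono nhdsWithin_le_nhds
  filter_upwards [self_mem_nhdsWithin, h1] with ε hε hεδ
  have hε : 0 < ε := hε
  refine ⟨hε, fun x hx => ?_⟩
  rintro _ ⟨y, hy, rfl⟩
  refine hsub (Metric.mem_thickening_iff.2 ⟨x, hx, ?_⟩)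
  rw [similarity_apply, dist_eq_norm, add_sub_cancel_right, norm_smul, norm_rotation_apply,
    Real.norm_of_nonneg hε.le]
  have h2 : ‖y‖ ≤ |r| := (mem_closedBall_zero_iff.1 (hr hy)).trans (le_abs_self r)
  rw [lt_div_iff₀ (by positivity)] at hεδ
  nlinarith

/-- Hölder bounds `∫ φ U_ε` by `ε (C M)^{1/p} ‖φ‖_q` whenever `G_ε(u, Ω) < M`. The factor `ε⁻¹`
cancels, and the bound passes to the limit of `ε⁻¹ ∫ φ U_ε`. -/
theorem momentFunctional_mem_gradientFunctionals
    (hα : IsCoreFunctional p D (similarityGroup G) α)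
    (hp : 1 < p) {q : ℝ} (hpq : p.HolderConjugate q) (hD : MeasurableSet D)
    (hDb : Bornology.IsBounded D) {w : E n → E m}
    (hwm : AEStronglyMeasurable w volume) (hwi : IntegrableOn w D)
    (hw : ∀ v, MemLpLoc p v → |∫ x in D, ⟪v x, w x⟫| ^ p ≤ α v D)
    {R : Matrix.specialOrthogonalGroup (Fin n) ℝ} (hR : R ∈ G) {Ω : Set (E n)} (hΩ : IsOpen Ω)
    {u : E n → E m} (hu : MemLpLoc p u) (hfin : bmoLiminf p D G α u Ω < ⊤) :
    momentFunctional hD hDb hwi R ∈ gradientFunctionals hp Ω (hu.locallyIntegrable hp.le) := by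
  have hp0 : 0 < p := by linarith
  have hq0 : 0 < q := hpq.symm.pos
  set T := momentFunctional hD hDb hwi R with hT
  have hui := hu.locallyIntegrable hp.le
  obtain ⟨C, hC, hbound⟩ := exists_lintegral_rpow_average_le hα hp hDb hwm hw hR
  obtain ⟨M, hM1, hM2⟩ := exists_between hfin
  have hfreq : ∃ᶠ ε in 𝓝[>] (0 : ℝ), bmo p D G α ε u Ω < M :=
    frequently_lt_of_liminf_lt (by isBoundedDefault) hM1
  -- `α` vanishes on constants, and it dominates the pairing with `w`.
  have hconst : ∀ c : E m, ∫ y in D, ⟪c, w y⟫ = 0 := fun c => by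
    have h1 := hw (fun _ => c) (memLpLoc_of_continuous continuous_const)
    rw [hα.apply_const hp, NNReal.coe_zero] at h1
    have h2 := h1.antisymm (by positivity)
    rw [Real.rpow_eq_zero (abs_nonneg _) hp0.ne', abs_eq_zero] at h2
    exact h2
  refine mem_gradientFunctionals_of_enorm_le hp hpq hui (C := (C * M.toReal) ^ (1 / p))
    (by positivity) fun φ hφ => ?_
  have hlim := tendsto_integral_average hD hDb hwi hwm hconst hui R hφ.1 hφ.2.1
  have hΩint : ∫ x in Ω, T (tensorGrad u φ x) = ∫ x, T (tensorGrad u φ x) :=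
    setIntegral_eq_integral_of_forall_compl_eq_zero fun x hx => by
      rw [tensorGrad_eq_zero fun hh => hx (hφ.2.2 hh), map_zero]
  rw [hΩint, ← enorm_neg]
  set K := tsupport φ with hK
  have hKm : MeasurableSet K := (isClosed_tsupport φ).measurableSet
  have hest : ∃ᶠ ε in 𝓝[>] (0 : ℝ), ‖ε⁻¹ * ∫ x, φ x * average D w u R ε x‖ₑ ≤
      ENNReal.ofReal ((C * M.toReal) ^ (1 / p)) *
        eLpNorm φ (ENNReal.ofReal q) (volume.restrict Ω) := by
    refine (hfreq.and_eventually (exists_forall_similarity_image_subset hDb hΩ hφ.2.1.isCompact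
      hφ.2.2 R)).mono fun ε hε => ?_
    obtain ⟨hεM, hε, hsub⟩ := hε
    have h1 := hbound u hu Ω K hKm ε hε hsub
    have h2 : ∫⁻ x in K, ‖average D w u R ε x‖ₑ ^ p ≤ ENNReal.ofReal (C * ε ^ p * M.toReal) := by
      refine h1.trans ?_
      rw [ENNReal.ofReal_mul (p := C * ε ^ p) (by positivity), ENNReal.ofReal_toReal hM2.ne]
      gcongr
    have hφi : ∫ x, φ x * average D w u R ε x = ∫ x in K, φ x * average D w u R ε x :=
      (setIntegral_eq_integral_of_forall_compl_eq_zero fun x hx => by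
        rw [image_eq_zero_of_notMem_tsupport hx, zero_mul]).symm
    have hholder := ENNReal.lintegral_mul_le_Lp_mul_Lq (volume.restrict K) hpq
      (aestronglyMeasurable_average hui.aestronglyMeasurable hwm D R ε).restrict.enorm
      (hφ.1.continuous.aestronglyMeasurable (μ := volume.restrict K)).enorm
    have hφq : (∫⁻ x in K, ‖φ x‖ₑ ^ q) ^ (1 / q) ≤
        eLpNorm φ (ENNReal.ofReal q) (volume.restrict Ω) := by
      rw [eLpNorm_eq_lintegral_rpow_enorm_toReal (by simpa using hq0) (by simp),
        ENNReal.toReal_ofReal hq0.le]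
      refine ENNReal.rpow_le_rpow ?_ (by positivity)
      exact lintegral_mono_set hφ.2.2
    have h3 : ‖∫ x, φ x * average D w u R ε x‖ₑ ≤
        ENNReal.ofReal (ε * (C * M.toReal) ^ (1 / p)) *
          eLpNorm φ (ENNReal.ofReal q) (volume.restrict Ω) := by
      rw [hφi]
      refine (enorm_integral_le_lintegral_enorm _).trans ?_
      refine le_trans (le_of_eq (lintegral_congr fun x => ?_)) (hholder.trans
        (mul_le_mul' ?_ hφq))
      · rw [enorm_mul, Pi.mul_apply, mul_comm]
      · refine (ENNReal.rpow_le_rpow h2 (by positivity)).trans_eq ?_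
        rw [ENNReal.ofReal_rpow_of_nonneg (by positivity) (by positivity)]
        congr 1
        rw [mul_right_comm, mul_comm, Real.mul_rpow (by positivity) (by positivity),
          ← Real.rpow_mul hε.le, mul_one_div_cancel hp0.ne', Real.rpow_one]
    rw [enorm_mul]
    refine (mul_le_mul_right h3 _).trans_eq ?_
    rw [← ofReal_norm, Real.norm_of_nonneg (by positivity), ← mul_assoc,
      ← ENNReal.ofReal_mul (by positivity), inv_mul_cancel_left₀ hε.ne']
  -- The estimate holds only for arbitrarily small `ε`, which suffices because the full limit
  -- exists.
  by_contra hcon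
  rw [not_le] at hcon
  have hev := (hlim.enorm).eventually_const_lt hcon
  exact hest (hev.mono fun ε h => not_le.2 h)

/-- The functionals that vanish on the kernel of `ψ` map the gradient into `L^p`. -/
theorem dualAnnihilator_psiKernel_le (hα : IsCoreFunctional p D (similarityGroup G) α)
    (hp : 1 < p) (hlsc : IsLpLowerSemicontinuous p hp.le D (similarityGroup G) α)
    (hD : MeasurableSet D) (hDb : Bornology.IsBounded D) {Ω : Set (E n)} (hΩ : IsOpen Ω)
    {u : E n → E m} (hu : MemLpLoc p u) (hfin : bmoLiminf p D G α u Ω < ⊤) :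
    (psiKernel hα hp).dualAnnihilator ≤
      gradientFunctionals hp Ω (hu.locallyIntegrable hp.le) := by
  obtain ⟨q, hpq⟩ : ∃ q, p.HolderConjugate q := ⟨_, Real.HolderConjugate.conjExponent hp⟩
  set W := gradientFunctionals hp Ω (hu.locallyIntegrable hp.le) with hW
  -- If `α(AR, D) ≠ 0`, the moment functional of the corresponding `w` belongs to `W` and does not
  -- vanish at `A`.
  have hle : W.dualCoannihilator ≤ psiKernel hα hp := by
    intro A hA R hR
    by_contra hne
    obtain ⟨w, hw, hwle, hwne⟩ := hα.exists_memLp_rpow_abs_integral_inner_le hp hlsc hD hDb hpq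
      (memLpLoc_of_continuous (A.comp (rotation R)).continuous) hne
    have hfinm : IsFiniteMeasure (volume.restrict D) :=
      isFiniteMeasure_restrict.2 hDb.measure_lt_top.ne
    have hwi : IntegrableOn w D :=
      (hw.restrict D).integrable (ENNReal.one_le_ofReal.2 hpq.symm.lt.le)
    have hmem := momentFunctional_mem_gradientFunctionals hα hp hpq hD hDb hw.1 hwi hwle hR hΩ hu
      hfin
    exact hwne ((Submodule.mem_dualCoannihilator _).1 hA _ hmem)
  calc (psiKernel hα hp).dualAnnihilator ≤ W.dualCoannihilator.dualAnnihilator :=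
        Submodule.dualAnnihilator_anti hle
    _ = W := Subspace.dualCoannihilator_dualAnnihilator_eq

theorem memLp_sum_smul_const {X F ι : Type*} [MeasurableSpace X] {μ : Measure X}
    [NormedAddCommGroup F] [NormedSpace ℝ F] [Fintype ι] {q : ℝ≥0∞} {g : ι → X → ℝ}
    (hg : ∀ i, MemLp (g i) q μ) (v : ι → F) : MemLp (fun x => ∑ i, g i x • v i) q μ :=
  memLp_finsetSum Finset.univ fun i _ =>
    (ContinuousLinearMap.toSpanSingleton ℝ (v i)).comp_memLp' (hg i)

theorem integral_smul_sum_smul_const {X F ι : Type*} [MeasurableSpace X] {μ : Measure X}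
    [NormedAddCommGroup F] [NormedSpace ℝ F] [CompleteSpace F] [Fintype ι] {φ : X → ℝ}
    {g : ι → X → ℝ} (hg : ∀ i, Integrable (fun x => φ x * g i x) μ) (v : ι → F) :
    ∫ x, φ x • ∑ i, g i x • v i ∂μ = ∑ i, (∫ x, φ x * g i x ∂μ) • v i := by
  simp_rw [Finset.smul_sum, smul_smul]
  rw [integral_finsetSum _ fun i _ => (hg i).smul_const _]
  exact Finset.sum_congr rfl fun i _ => integral_smul_const _ _

theorem sum_neg_coord_smul {F ι : Type*} [AddCommGroup F] [Module ℝ F] [Fintype ι]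
    (b : Module.Basis ι ℝ F) (v : F) : ∑ i, (-b.coord i v) • b i = -v := by
  simp_rw [neg_smul, Finset.sum_neg_distrib, Module.Basis.coord_apply, b.sum_repr]

/-- The scalar densities of the coordinates are reassembled in the basis. -/
theorem weakDMemLp_of_forall_coord_comp_mem (hp : 1 < p) {Ω : Set (E n)} {u : E n → E m}
    (hu : LocallyIntegrable u volume) {ι : Type*} [Fintype ι]
    (b : Module.Basis ι ℝ (Mat m n)) (L : Mat m n →ₗ[ℝ] Mat m n)
    (h : ∀ i, b.coord i ∘ₗ L ∈ gradientFunctionals hp Ω hu) : WeakDMemLp p L Ω u := by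
  have h' : ∀ i, ∃ g : E n → ℝ, MemLp g (ENNReal.ofReal p) (volume.restrict Ω) ∧
      ∀ φ ∈ testFunctions Ω, ∫ x in Ω, φ x * g x =
        -∫ x in Ω, b.coord i (L (tensorGrad u φ x)) := h
  choose g hg hrep using h'
  refine ⟨fun x => ∑ i, g i x • b i, memLp_sum_smul_const hg b, ?_⟩
  intro φ hφ hc hsupp
  have hint : Integrable (fun x => L (tensorGrad u φ x)) (volume.restrict Ω) :=
    ((LinearMap.toContinuousLinearMap L).integrable_comp
      (LocallyIntegrable.tensorGrad hu hφ hc)).restrict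
  have hcoord : ∀ i, ∫ x in Ω, b.coord i (L (tensorGrad u φ x)) =
      b.coord i (∫ x in Ω, L (tensorGrad u φ x)) := fun i =>
    (LinearMap.toContinuousLinearMap (b.coord i)).integral_comp_comm hint
  have hsum : ∫ x in Ω, φ x • ∑ i, g i x • b i = ∑ i, (∫ x in Ω, φ x * g i x) • b i :=
    integral_smul_sum_smul_const
      (fun i => integrable_mul_of_memLp hp (hg i) hφ.continuous hc) b
  have hcoeff : ∀ i, ∫ x in Ω, φ x * g i x = -b.coord i (∫ x in Ω, L (tensorGrad u φ x)) :=
    fun i => (hrep i φ ⟨hφ, hc, hsupp⟩).trans (congrArg Neg.neg (hcoord i))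
  rw [hsum]
  simp_rw [hcoeff]
  exact sum_neg_coord_smul b _

/-- Each coordinate of `L` annihilates the kernel of `ψ`. Asking only that `L` vanish there serves
the projections and also the identity when the kernel is trivial. -/
theorem weakDMemLp_projection (hα : IsCoreFunctional p D (similarityGroup G) α)
    (hp : 1 < p) (hlsc : IsLpLowerSemicontinuous p hp.le D (similarityGroup G) α)
    (hD : MeasurableSet D) (hDb : Bornology.IsBounded D) {Ω : Set (E n)} (hΩ : IsOpen Ω)
    {u : E n → E m} (hu : MemLpLoc p u) (hfin : bmoLiminf p D G α u Ω < ⊤)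
    (L : Mat m n →ₗ[ℝ] Mat m n) (hL : psiKernel hα hp ≤ LinearMap.ker L) :
    WeakDMemLp p L Ω u := by
  refine weakDMemLp_of_forall_coord_comp_mem hp (hu.locallyIntegrable hp.le)
    (Module.finBasis ℝ (Mat m n)) L fun i => ?_
  refine dualAnnihilator_psiKernel_le hα hp hlsc hD hDb hΩ hu hfin ?_
  rw [Submodule.mem_dualAnnihilator]
  intro A hA
  rw [LinearMap.comp_apply, LinearMap.mem_ker.1 (hL hA), map_zero]

end BMOType

end

/-! ### The main theorem. -/

theorem mainTheorem4 (n m : ℕ) (hn : 1 ≤ n) (hm : 1 ≤ m) (p : ℝ) (hp : 1 < p)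
    (Ω D : Set (BMOType.E n)) (hΩ : IsOpen Ω) (hD : IsOpen D) (hDb : Bornology.IsBounded D)
    (G : Subgroup (Matrix.specialOrthogonalGroup (Fin n) ℝ))
    (α : (BMOType.E n → BMOType.E m) → Set (BMOType.E n) → ℝ≥0)
    (hα : BMOType.IsCoreFunctional p D (BMOType.similarityGroup G) α)
    (hlsc : BMOType.IsLpLowerSemicontinuous p hp.le D (BMOType.similarityGroup G) α) :
    -- the limit that defines `ψ` exists and is finite
    (∀ A : BMOType.Mat m n,
      Tendsto (fun ε : ℝ => BMOType.bmo p D G α ε (A : BMOType.E n → BMOType.E m)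
        (BMOType.unitCube n)) (𝓝[>] 0) (𝓝 (BMOType.psi p D G α A)) ∧
      BMOType.psi p D G α A < ⊤) ∧
    -- the zero set of `ψ` is a linear subspace `N`, and the implication holds for the projection
    -- onto any complement `P` of `N`, along `N`
    (∃ N : Submodule ℝ (BMOType.Mat m n),
      (N : Set (BMOType.Mat m n)) = {A | BMOType.psi p D G α A = 0} ∧
      ∀ (P : Submodule ℝ (BMOType.Mat m n)) (hPN : IsCompl P N)
        (u : BMOType.E n → BMOType.E m), BMOType.MemLpLoc p u →
        BMOType.bmoLiminf p D G α u Ω < ⊤ →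
        BMOType.WeakDMemLp p (P.projection N hPN) Ω u) ∧
    -- the characterization when `ψ` is positive off `0`
    ((∀ A : BMOType.Mat m n, A ≠ 0 → 0 < BMOType.psi p D G α A) →
      ∀ u : BMOType.E n → BMOType.E m, BMOType.MemLpLoc p u →
        (BMOType.GradMemLp p Ω u ↔ BMOType.bmoLiminf p D G α u Ω < ⊤)) := by
  refine ⟨fun A => ⟨?_, BMOType.psi_lt_top hα hp hD hDb A⟩,
    ⟨BMOType.psiKernel hα hp, BMOType.coe_psiKernel hα hp hDb, fun P hPN u hu hfin => ?_⟩,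
    fun hpos u hu => ⟨?_, fun hfin => ?_⟩⟩
  · rw [BMOType.psi_eq_iSup hα hp]
    exact BMOType.tendsto_bmo_unitCube hα hp A
  · exact BMOType.weakDMemLp_projection hα hp hlsc hD.measurableSet hDb hΩ hu hfin _
      (Submodule.ker_projection hPN).ge
  · rintro ⟨g, hg, hgw⟩
    obtain ⟨c₁, hc₁⟩ := BMOType.exists_bmo_le hα hp hD hDb
    -- The gradient bound is uniform in `ε`, so it bounds every eventual lower bound `b`.
    refine lt_of_le_of_lt (liminf_le_of_le (by isBoundedDefault) fun b hb => ?_)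
      (ENNReal.ofReal_lt_top (r := c₁ * ∫ x in Ω, ‖g x‖ ^ p))
    obtain ⟨ε, hbε, hε⟩ := (hb.and self_mem_nhdsWithin).exists
    exact hbε.trans (hc₁ u hu Ω hΩ.measurableSet g hg hgw ε hε)
  -- Applied to the identity: positivity of `ψ` off `0` makes the kernel trivial.
  · refine BMOType.weakDMemLp_projection hα hp hlsc hD.measurableSet hDb hΩ hu hfin _
      fun A hA => ?_
    have h0 : BMOType.psi p D G α A = 0 := (BMOType.coe_psiKernel hα hp hDb).le hA
    by_contra hA0
    exact (hpos A fun h => hA0 (by simp [h])).ne' h0
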